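/- **Conventions.** A partial linear space is a non-empty set $P$ of points with a family of proper subsets, called lines, such that every line has at least two points, every point lies on a line, and two distinct points lie on at most one common line; points are collinear if some line contains both (so every point is collinear to itself). A subspace is a set of points that contains, with any two distinct collinear points, the line joining them; it is singular if its points are mutually collinear. A singular subspace has dimension $d$ if the least number of points spanning it is $d+1$ (so $\dim\emptyset=-1$). A *polar space* is a partial linear space in which every line has at least three points, no point is collinear to all points, for every point $p$ and line $L$ the point $p$ is collinear to exactly one or to all points of $L$, and every chain of distinct singular subspaces is finite; it has rank $n$ if all its maximal singular subspaces have dimension $n-1$. A *thin polar space* of rank $n$ is a partial linear space isomorphic to the one with point set $\{\pm1,\dots,\pm n\}$ whose lines are the two-element subsets $\{i,j\}$ with $j\neq -i$. For a (thin) polar space $\Pi$ of rank $n$ and $0\le k\le n-1$, the graph $\Gamma_k(\Pi)$ has as vertices the $k$-dimensional singular subspaces of $\Pi$. Two distinct vertices are adjacent if they lie in a common $(k+1)$-dimensional singular subspace when $k\le n-2$, and if their intersection is $(n-2)$-dimensional when $k=n-1$. For a singular subspace $S$, $[S\rangle_k$ is the set of all $k$-dimensional singular subspaces containing $S$. If $\dim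 S=m-1$, then $\Pi_S$ is the geometry with point set $[S\rangle_m$ whose lines are the sets $\{X\in[S\rangle_m : X\subset U\}$ for $U\in[S\rangle_{m+1}$. The $i$-dimensional singular subspace $\{X\in[S\rangle_m : X\subset U\}$ of $\Pi_S$ is identified with $U\in[S\rangle_{m+i}$. A collinearity preserving injection is an injective map of points that sends collinear points to collinear points and non-collinear points to non-collinear points. An isometric embedding of graphs is an injection of the vertex sets that preserves adjacency, non-adjacency and distance. **Theorem.** Let $\Pi$ be a polar space or a thin polar space of rank $n\ge 5$, let $\Pi'$ be a polar space of rank $n'$, let $1\le k\le n-4$ and $0\le k'\le n'-1$, and let $f$ be an isometric embedding of $\Gamma_k(\Pi)$ in $\Gamma_{k'}(\Pi')$. Then $$k\le k',\qquad n-k\le n'-k',$$ and there is a $(k'-k-1)$-dimensional singular subspace $S$ of $\Pi'$ such that the image of $f$ is contained in $[S\rangle_{k'}$ and $f$ is induced by a collinearity preserving injection $\alpha$ of $\Pi$ to $\Pi'_S$; that is, for every $k$-dimensional singular subspace $X$ of $\Pi$, the subspace of $\Pi'_S$ spanned by $\alpha(X)$ is the $k$-dimensional singular subspace of $\Pi'_S$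 identified with $f(X)$, namely the set of all $Y\in[S\rangle_{k'-k}$ with $Y\subset f(X)$. -/

import Mathlib

universe u v

/-- A point-line geometry on the point type `P`: a family of sets of points, called lines.
No law is built in; partial linear spaces and polar spaces are singled out by predicates. -/
structure PointLineGeometry (P : Type u) where
  lines : Set (Set P)

namespace PointLineGeometry

variable {P : Type u}

/-- Some line contains both points. In a partial linear space every point lies on a line, so
there every point is collinear to itself. -/
def Collinear (G : PointLineGeometry P) (p q : P) : Prop :=
  ∃ L ∈ G.lines, p ∈ L ∧ q ∈ L

structure IsPartialLinearSpace (G : PointLineGeometry P) : Prop where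
  nonempty : Nonempty P
  line_ne_univ : ∀ L ∈ G.lines, L ≠ Set.univ
  line_nontrivial : ∀ L ∈ G.lines, L.Nontrivial
  exists_line : ∀ p, ∃ L ∈ G.lines, p ∈ L
  line_unique : ∀ p q, p ≠ q → ∀ L ∈ G.lines, ∀ M ∈ G.lines,
    p ∈ L → q ∈ L → p ∈ M → q ∈ M → L = M

/-- A set of points containing, with any two distinct collinear points, the line joining them. -/
def IsSubspace (G : PointLineGeometry P) (S : Set P) : Prop :=
  ∀ p ∈ S, ∀ q ∈ S, p ≠ q → ∀ L ∈ G.lines, p ∈ L → q ∈ L → L ⊆ S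

/-- A subspace whose points are mutually collinear. -/
def IsSingular (G : PointLineGeometry P) (S : Set P) : Prop :=
  G.IsSubspace S ∧ ∀ p ∈ S, ∀ q ∈ S, p ≠ q → G.Collinear p q

/-- The smallest subspace containing `X`. -/
def span (G : PointLineGeometry P) (X : Set P) : Set P :=
  ⋂₀ {T | G.IsSubspace T ∧ X ⊆ T}

/-- `S` has (projective) dimension `d`: the least number of points that span `S` is `d + 1`.
The empty set has dimension `-1`, points have dimension `0`, lines have dimension `1`. -/
def HasDim (G : PointLineGeometry P) (S : Set P) (d : ℤ) : Prop :=
  IsLeast {m : ℤ | ∃ X : Finset P, G.span (X : Set P) = S ∧ m = (X.card : ℤ) - 1} d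

structure IsPolarSpace (G : PointLineGeometry P) : Prop extends G.IsPartialLinearSpace where
  three_le_line : ∀ L ∈ G.lines, 3 ≤ L.encard
  not_collinear_all : ¬ ∃ p, ∀ q, G.Collinear p q
  one_or_all : ∀ p, ∀ L ∈ G.lines,
    (∃! q, q ∈ L ∧ G.Collinear p q) ∨ ∀ q ∈ L, G.Collinear p q
  finite_chain : ∀ C : Set (Set P), (∀ S ∈ C, G.IsSingular S) →
    IsChain (· ⊆ ·) C → C.Finite

/-- All maximal singular subspaces have dimension `n - 1`. -/
def HasRank (G : PointLineGeometry P) (n : ℕ) : Prop :=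
  ∀ M, Maximal G.IsSingular M → G.HasDim M ((n : ℤ) - 1)

/-- The standard thin polar space on `{±1, …, ±n}`: the pairs `(i, true)` and `(i, false)` stand
for the two opposite points `±i`, and the lines are the two-element sets of non-opposite points. -/
def standardThin (n : ℕ) : PointLineGeometry (Fin n × Bool) where
  lines := {L | ∃ x y : Fin n × Bool, x.1 ≠ y.1 ∧ L = {x, y}}

/-- Isomorphic, by a collineation, to the standard thin polar space of rank `n`. -/
def IsThinPolarSpace (G : PointLineGeometry P) (n : ℕ) : Prop :=
  ∃ α : P ≃ Fin n × Bool, (fun L => α '' L) '' G.lines = (standardThin n).lines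

/-- The set of `k`-dimensional singular subspaces. -/
def grassmannian (G : PointLineGeometry P) (k : ℤ) : Set (Set P) :=
  {S | G.IsSingular S ∧ G.HasDim S k}

/-- The Grassmann graph of the `k`-dimensional singular subspaces of a space of rank `n`. For
`k ≤ n - 2` distinct vertices are adjacent if a `(k+1)`-dimensional singular subspace contains
both; for `k = n - 1` if their intersection is `(k-1)`-dimensional. -/
def grassmannGraph (G : PointLineGeometry P) (n : ℕ) (k : ℤ) :
    SimpleGraph (G.grassmannian k) where
  Adj X Y := X ≠ Y ∧
    ((k ≤ (n : ℤ) - 2 ∧ ∃ U ∈ G.grassmannian (k + 1), X.1 ⊆ U ∧ Y.1 ⊆ U) ∨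
      (k = (n : ℤ) - 1 ∧ G.HasDim (X.1 ∩ Y.1) (k - 1)))
  symm := ⟨by
    rintro X Y ⟨hne, ⟨hk, U, hU, hX, hY⟩ | ⟨hk, h⟩⟩
    · exact ⟨hne.symm, Or.inl ⟨hk, U, hU, hY, hX⟩⟩
    · exact ⟨hne.symm, Or.inr ⟨hk, by rwa [Set.inter_comm]⟩⟩⟩
  loopless := ⟨fun _ h => h.1 rfl⟩

/-- The set `[S⟩_k` of all `k`-dimensional singular subspaces containing `S`. -/
def bigStar (G : PointLineGeometry P) (S : Set P) (k : ℤ) : Set (G.grassmannian k) :=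
  {X | S ⊆ X.1}

/-- The points of the quotient by `S`: the singular subspaces that contain `S` and have
dimension `dim S + 1`. -/
def quotientPoints (G : PointLineGeometry P) (S : Set P) : Set (Set P) :=
  {X | S ⊆ X ∧ ∃ d, G.HasDim S d ∧ X ∈ G.grassmannian (d + 1)}

/-- The quotient by `S`. Its lines are the sets of all points `X` with `S ⊆ X ⊆ U`, where `U` is a
singular subspace of dimension `dim S + 2` that contains `S`. -/
def quotient (G : PointLineGeometry P) (S : Set P) :
    PointLineGeometry (G.quotientPoints S) where
  lines := {L | ∃ d, G.HasDim S d ∧ ∃ U ∈ G.grassmannian (d + 2), S ⊆ U ∧ L = {X | X.1 ⊆ U}}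

/-- A collinearity preserving injection: collinear points go to collinear points and
non-collinear points go to non-collinear points. -/
structure IsCollinearityPreservingInjection {Q : Type v} (G : PointLineGeometry P)
    (H : PointLineGeometry Q) (α : P → Q) : Prop where
  injective : Function.Injective α
  collinear_iff : ∀ p q, H.Collinear (α p) (α q) ↔ G.Collinear p q

/-- The map `f` from `k`-dimensional singular subspaces of `G` to `k'`-dimensional ones of `H` is
induced by the map `α` from the points of `G` to the points of the quotient of `H` by `S`: the
subspace of the quotient spanned by `α(X)` consists of the points `Y` with `S ⊆ Y ⊆ f(X)`; this
set is the singular subspace of the quotient that is identified with `f(X)`. -/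
def IsInducedBy {Q : Type v} (G : PointLineGeometry P) (H : PointLineGeometry Q) {k k' : ℤ}
    (f : G.grassmannian k → H.grassmannian k') (S : Set Q) (α : P → H.quotientPoints S) : Prop :=
  ∀ X : G.grassmannian k, (H.quotient S).span (α '' X.1) = {Y | Y.1 ⊆ (f X).1}

end PointLineGeometry

/-!
Polar spaces and thin polar spaces are treated together as nondegenerate Shult spaces.

The embedding is pushed down from dimension `k` to dimension `0`. If `F` maps the `(i+1)`-spaces of
`Π` to subspaces of `Π'` and preserves adjacency and local non-adjacency, then the images of the
`(i+1)`-spaces on an `i`-space `R` share a hyperplane, which becomes the image of `R`: three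
mutually adjacent images share a hyperplane or span a subspace only one dimension larger,
connectedness of the residue of `R` spreads either alternative to the whole residue, and the second
one is impossible since it would make the images of non-collinear points of the residue adjacent.
This needs rank at least `4` in the residue of `R`, hence `k ≤ n - 4`.

Distances enter once, to show that the new map separates two `i`-spaces that share a hyperplane `Q`.
Such spaces extend to `k`-spaces that are opposite in the residue of `Q`, hence as far apart as
possible, whereas a coincidence of their images would bring the images of the `k`-spaces closer.
Graphs of maximal singular subspaces are excluded as targets because in them two triangles on a
common edge lie in a clique.

In dimension `0` the images of all points share a subspace `S`, and the points of `Π` thus become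
points of `Π'_S`. Applying this map along a maximal singular subspace of `Π` yields a singular
subspace of `Π'_S` of dimension at least `n - 1`, which gives the inequality between the ranks.
-/

namespace PointLineGeometry

variable {P : Type u} {G : PointLineGeometry P}

theorem Collinear.symm {p q : P} (h : G.Collinear p q) : G.Collinear q p :=
  h.imp fun _ ⟨hL, hp, hq⟩ => ⟨hL, hq, hp⟩

theorem subset_span (X : Set P) : X ⊆ G.span X := fun _ hx _ hT => hT.2 hx

theorem span_subset {X T : Set P} (hT : G.IsSubspace T) (h : X ⊆ T) : G.span X ⊆ T :=
  fun _ hx => hx T ⟨hT, h⟩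

theorem isSubspace_span (X : Set P) : G.IsSubspace (G.span X) :=
  fun p hp q hq hpq L hL hpL hqL _ hx T hT =>
    hT.1 p (hp T hT) q (hq T hT) hpq L hL hpL hqL hx

theorem span_mono {X Y : Set P} (h : X ⊆ Y) : G.span X ⊆ G.span Y :=
  span_subset (isSubspace_span Y) (h.trans (subset_span Y))

theorem IsSubspace.span_eq {X : Set P} (h : G.IsSubspace X) : G.span X = X :=
  (span_subset h subset_rfl).antisymm (subset_span X)

theorem span_insert_span (p : P) (X : Set P) :
    G.span (insert p (G.span X)) = G.span (insert p X) := by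
  refine (span_subset (isSubspace_span _) (Set.insert_subset ?_ ?_)).antisymm
    (span_mono (Set.insert_subset_insert (subset_span X)))
  · exact subset_span _ (Set.mem_insert p X)
  · exact span_mono (Set.subset_insert p X)

theorem IsSubspace.inter {X Y : Set P} (hX : G.IsSubspace X) (hY : G.IsSubspace Y) :
    G.IsSubspace (X ∩ Y) := fun p hp q hq hpq L hL hpL hqL =>
  Set.subset_inter (hX p hp.1 q hq.1 hpq L hL hpL hqL) (hY p hp.2 q hq.2 hpq L hL hpL hqL)

theorem IsSingular.inter {X Y : Set P} (hX : G.IsSingular X) (hY : G.IsSubspace Y) :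
    G.IsSingular (X ∩ Y) :=
  ⟨hX.1.inter hY, fun p hp q hq => hX.2 p hp.1 q hq.1⟩

theorem isSingular_empty : G.IsSingular ∅ :=
  ⟨fun _ h => h.elim, fun _ h => h.elim⟩

/-- The set `A^⊥` of all points collinear to all points of `A`. Two sets `A` and `B` are mutually
collinear if `A ⊆ B^⊥`. -/
def perp (G : PointLineGeometry P) (A : Set P) : Set P :=
  {x | ∀ a ∈ A, G.Collinear x a}

theorem perp_anti {A B : Set P} (h : A ⊆ B) : G.perp B ⊆ G.perp A :=
  fun _ hx a ha => hx a (h ha)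

theorem mem_perp_singleton {p x : P} : x ∈ G.perp {p} ↔ G.Collinear x p := by
  simp only [perp, Set.mem_singleton_iff, forall_eq, Set.mem_ofPred_eq]

theorem mem_perp_insert {A : Set P} {p x : P} :
    x ∈ G.perp (insert p A) ↔ G.Collinear x p ∧ x ∈ G.perp A := by
  simp only [perp, Set.mem_insert_iff, forall_eq_or_imp, Set.mem_ofPred_eq]

theorem subset_perp_comm {A B : Set P} : A ⊆ G.perp B ↔ B ⊆ G.perp A :=
  ⟨fun h _ hb _ ha => (h ha _ hb).symm, fun h _ ha _ hb => (h hb _ ha).symm⟩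

/-- The point set of the residue of `N`: the points outside `N` that are collinear to all points
of `N`. The points of the quotient by `N` are the subspaces spanned by `N` and such a point. -/
def residue (G : PointLineGeometry P) (N : Set P) : Set P :=
  G.perp N \ N

theorem residue_anti {R N : Set P} (h : R ⊆ N) : G.residue N ⊆ G.residue R :=
  fun _ hx => ⟨perp_anti h hx.1, fun hR => hx.2 (h hR)⟩

/-- The subspace `⟨N, p⟩` spanned by a set `N` and a point `p`. -/
def adjoin (G : PointLineGeometry P) (N : Set P) (p : P) : Set P :=
  G.span (insert p N)

theorem subset_adjoin (N : Set P) (p : P) : N ⊆ G.adjoin N p :=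
  (Set.subset_insert p N).trans (subset_span _)

theorem mem_adjoin (N : Set P) (p : P) : p ∈ G.adjoin N p :=
  subset_span _ (Set.mem_insert p N)

theorem isSubspace_adjoin (N : Set P) (p : P) : G.IsSubspace (G.adjoin N p) :=
  isSubspace_span _

theorem adjoin_subset {N T : Set P} {p : P} (hT : G.IsSubspace T) (h : N ⊆ T) (hp : p ∈ T) :
    G.adjoin N p ⊆ T :=
  span_subset hT (Set.insert_subset hp h)

theorem IsSingular.adjoin_inter_eq {X H : Set P} {p : P} (hX : G.IsSingular X)
    (h : ∀ L ∈ G.lines, L ⊆ X → ∃ x ∈ L, x ∈ H) (hp : p ∈ X) (hpH : p ∉ H) :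
    G.adjoin (X ∩ H) p = X := by
  refine (adjoin_subset hX.1 Set.inter_subset_left hp).antisymm fun y hy => ?_
  by_cases hyp : p = y
  · exact hyp ▸ mem_adjoin _ _
  obtain ⟨L, hL, hpL, hyL⟩ := hX.2 p hp y hy hyp
  have hLX := hX.1 p hp y hy hyp L hL hpL hyL
  obtain ⟨x, hxL, hxH⟩ := h L hL hLX
  have hxp : x ≠ p := ne_of_mem_of_not_mem hxH hpH
  exact isSubspace_adjoin _ _ x (subset_adjoin (X ∩ H) _ ⟨hLX hxL, hxH⟩) p (mem_adjoin _ _) hxp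
    L hL hxL hpL hyL

/-- A nondegenerate Shult space of finite rank: a point is collinear to one or all points of a
line, no point is collinear to all points, and chains of singular subspaces are finite. Nothing is
asked of the number of points on a line or of the number of lines through two points, so polar
spaces and thin polar spaces are both of this kind. -/
class IsShultSpace (G : PointLineGeometry P) : Prop where
  exists_line : ∀ p, ∃ L ∈ G.lines, p ∈ L
  exists_collinear : ∀ L ∈ G.lines, ∀ p, ∃ q ∈ L, G.Collinear p q
  collinear_of_mem_line : ∀ L ∈ G.lines, ∀ p, ∀ q ∈ L, ∀ r ∈ L, q ≠ r →
    G.Collinear p q → G.Collinear p r → ∀ s ∈ L, G.Collinear p s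
  exists_not_collinear : ∀ p, ∃ q, ¬ G.Collinear p q
  finite_chain : ∀ C : Set (Set P), (∀ S ∈ C, G.IsSingular S) → IsChain (· ⊆ ·) C → C.Finite

open IsShultSpace

/-- A subspace none of whose points is collinear to all of its points. -/
def IsNondegenerate (G : PointLineGeometry P) (R : Set P) : Prop :=
  G.IsSubspace R ∧ ∀ p ∈ R, ∃ q ∈ R, ¬ G.Collinear p q

/-- The rank of a singular subspace, which is one more than its dimension: the least number of
points that span it. It is `0` if no finite set of points spans the subspace. -/
noncomputable def rk (G : PointLineGeometry P) (N : Set P) : ℕ :=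
  sInf {m | ∃ X : Finset P, G.span (X : Set P) = N ∧ X.card = m}

theorem rk_le_card (X : Finset P) : G.rk (G.span (X : Set P)) ≤ X.card :=
  Nat.sInf_le ⟨X, rfl, rfl⟩

theorem rk_empty : G.rk ∅ = 0 := by
  have h := G.rk_le_card ∅
  rwa [Finset.coe_empty, isSingular_empty.1.span_eq, Finset.card_empty, Nat.le_zero] at h

/-- The singular subspaces of rank `m`, that is, of dimension `m - 1`. Counting by rank keeps the
arithmetic of dimensions in `ℕ`. -/
def flats (G : PointLineGeometry P) (m : ℕ) : Set (Set P) :=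
  {X | G.IsSingular X ∧ G.rk X = m}

theorem empty_mem_flats : ∅ ∈ G.flats 0 := ⟨isSingular_empty, rk_empty⟩

section Perp

variable [G.IsShultSpace]

theorem Collinear.refl (p : P) : G.Collinear p p := by
  obtain ⟨L, hL, hp⟩ := exists_line (G := G) p
  exact ⟨L, hL, hp, hp⟩

theorem isSubspace_perp (A : Set P) : G.IsSubspace (G.perp A) :=
  fun q hq r hr hqr L hL hqL hrL s hs a ha => (collinear_of_mem_line L hL a q hqL r hrL hqr
    (hq a ha).symm (hr a ha).symm s hs).symm

theorem perp_span (X : Set P) : G.perp (G.span X) = G.perp X :=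
  (perp_anti (subset_span X)).antisymm <| subset_perp_comm.1 <|
    span_subset (isSubspace_perp _) (subset_perp_comm.1 subset_rfl)

theorem mem_perp_adjoin {N : Set P} {p x : P} :
    x ∈ G.perp (G.adjoin N p) ↔ G.Collinear x p ∧ x ∈ G.perp N := by
  rw [adjoin, perp_span, mem_perp_insert]

theorem span_subset_perp_span {X Y : Set P} (h : X ⊆ G.perp Y) :
    G.span X ⊆ G.perp (G.span Y) := by
  rw [perp_span]
  exact span_subset (isSubspace_perp Y) h

theorem IsSingular.subset_perp {X : Set P} (h : G.IsSingular X) : X ⊆ G.perp X := by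
  intro a ha b hb
  obtain rfl | hab := eq_or_ne a b
  · exact .refl a
  · exact h.2 a ha b hb hab

theorem isSingular_span {X : Set P} (h : X ⊆ G.perp X) : G.IsSingular (G.span X) :=
  ⟨isSubspace_span X, fun _ hp q hq _ => span_subset_perp_span h hp q hq⟩

theorem isSingular_adjoin {N : Set P} {p : P} (hN : G.IsSingular N) (hp : p ∈ G.perp N) :
    G.IsSingular (G.adjoin N p) := by
  refine isSingular_span (Set.insert_subset ?_ fun x hx => ?_)
  · exact mem_perp_insert.2 ⟨.refl p, hp⟩
  · exact mem_perp_insert.2 ⟨(hp x hx).symm, hN.subset_perp hx⟩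

theorem IsSingular.mem_residue {N M : Set P} {p : P} (hM : G.IsSingular M) (h : N ⊆ M)
    (hp : p ∈ M) (hpN : p ∉ N) : p ∈ G.residue N :=
  ⟨perp_anti h (hM.subset_perp hp), hpN⟩

theorem mem_residue_adjoin {N : Set P} {p q : P} (hq : q ∈ G.residue N)
    (hqp : G.Collinear q p) (h : q ∉ G.adjoin N p) : q ∈ G.residue (G.adjoin N p) :=
  ⟨mem_perp_adjoin.2 ⟨hqp, hq.1⟩, h⟩

theorem exists_maximal {p : Set P → Prop} (hp : ∀ S, p S → G.IsSingular S) {A : Set P}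
    (hA : p A) : ∃ M, A ⊆ M ∧ Maximal p M := by
  refine zorn_subset_nonempty {S | p S} (fun c hc hchain hne => ?_) A hA
  obtain ⟨M, hM⟩ := (finite_chain c (fun S hS => hp S (hc hS)) hchain).exists_maximal hne
  exact ⟨M, hc hM.1, fun S hS => (hchain.total hM.1 hS).elim (hM.2 hS) id⟩

@[elab_as_elim]
theorem IsSingular.induction {motive : ∀ N, G.IsSingular N → Prop}
    (empty : motive ∅ isSingular_empty)
    (adjoin : ∀ N p (hN : G.IsSingular N) (hp : p ∈ G.residue N), motive N hN →
      motive (G.adjoin N p) (isSingular_adjoin hN hp.1))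
    {N : Set P} (hN : G.IsSingular N) : motive N hN := by
  obtain ⟨M, -, ⟨hMN, hM, hmot⟩, hmax⟩ :=
    exists_maximal (p := fun S => S ⊆ N ∧ ∃ hS, motive S hS) (fun S hS => hS.2.1)
      (A := ∅) ⟨Set.empty_subset N, isSingular_empty, empty⟩
  obtain rfl : M = N := by
    refine hMN.antisymm fun x hx => ?_
    by_contra hxM
    have hxr := hN.mem_residue hMN hx hxM
    exact hxM (hmax ⟨adjoin_subset hN.1 hMN hx, _, adjoin M x hM hxr hmot⟩ (subset_adjoin M x)
      (mem_adjoin M x))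
  exact hmot

end Perp

section Separation

variable [G.IsShultSpace]

/-- Otherwise `u^⊥ ⊆ t^⊥` whenever `t` lies on the line through `b` and `y`, and `u ∈ t^⊥` is not
collinear to `b`. All points `u ≠ t` of a suitable line through `t` are of this kind and their perps
cover `R`, so that `t` would be collinear to all points of `R`. -/
theorem IsNondegenerate.exists_collinear_not_collinear {R : Set P} (hR : G.IsNondegenerate R)
    {b y : P} (hb : b ∈ R) (hy : y ∈ R) (hby : b ≠ y) :
    ∃ w ∈ R, G.Collinear w b ∧ ¬ G.Collinear w y := by
  by_contra! hcon
  obtain ⟨L, hL, hbL, hyL⟩ := hcon b hb (.refl b)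
  have hLR : L ⊆ R := hR.1 b hb y hy hby L hL hbL hyL
  have perp_line : ∀ w ∈ R, G.Collinear w b → ∀ x ∈ L, G.Collinear w x := fun w hw hwb =>
    collinear_of_mem_line L hL w b hbL y hyL hby hwb (hcon w hw hwb)
  have perp_le : ∀ u ∈ R, ¬ G.Collinear u b → ∀ t ∈ L, G.Collinear u t →
      ∀ w ∈ R, G.Collinear w u → G.Collinear w t := by
    intro u hu hub t ht hut w hw hwu
    obtain rfl | hne := eq_or_ne w u
    · exact hut
    obtain ⟨M, hM, hwM, huM⟩ := hwu
    obtain ⟨x, hxM, hbx⟩ := exists_collinear M hM b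
    have hxR : x ∈ R := hR.1 w hw u hu hne M hM hwM huM hxM
    have hxu : x ≠ u := by rintro rfl; exact hub hbx.symm
    exact (collinear_of_mem_line M hM t x hxM u huM hxu (perp_line x hxR hbx.symm t ht).symm
      hut.symm w hwM).symm
  obtain ⟨u₁, hu₁, hbu₁⟩ := hR.2 b hb
  obtain ⟨t, ht, M, hM, huM, htM⟩ := exists_collinear L hL u₁
  obtain ⟨u₂, hu₂, htu₂⟩ := hR.2 t (hLR ht)
  have hu₁t : u₁ ≠ t := by rintro rfl; exact hbu₁ ⟨L, hL, hbL, ht⟩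
  have hMR : M ⊆ R := hR.1 _ hu₁ _ (hLR ht) hu₁t M hM huM htM
  obtain ⟨x, hxM, hx⟩ := exists_collinear M hM u₂
  have hxt : x ≠ t := by rintro rfl; exact htu₂ hx.symm
  have hxb : ¬ G.Collinear x b := fun h => hbu₁
    (collinear_of_mem_line M hM b x hxM t htM hxt h.symm ⟨L, hL, hbL, ht⟩ u₁ huM)
  exact htu₂ (perp_le x (hMR hxM) hxb t ht ⟨M, hM, hxM, htM⟩ u₂ hu₂ hx).symm

theorem isNondegenerate_univ : G.IsNondegenerate Set.univ :=
  ⟨fun _ _ _ _ _ _ _ _ _ => Set.subset_univ _, fun p _ =>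
    (exists_not_collinear p).imp fun _ h => ⟨trivial, h⟩⟩

theorem IsNondegenerate.inter_perp_pair {R : Set P} (hR : G.IsNondegenerate R) {b z : P}
    (hb : b ∈ R) (hzb : ¬ G.Collinear z b) : G.IsNondegenerate (R ∩ G.perp {b, z}) := by
  refine ⟨hR.1.inter (isSubspace_perp _), ?_⟩
  rintro y ⟨hy, hybz⟩
  obtain ⟨hyb, hyz⟩ := mem_perp_insert.1 hybz
  rw [mem_perp_singleton] at hyz
  have hne : b ≠ y := by rintro rfl; exact hzb hyz.symm
  obtain ⟨w, hw, hwb, hwy⟩ := hR.exists_collinear_not_collinear hb hy hne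
  have hwb' : w ≠ b := by rintro rfl; exact hwy hyb.symm
  obtain ⟨L, hL, hwL, hbL⟩ := hwb
  obtain ⟨x, hxL, hzx⟩ := exists_collinear L hL z
  have hxb : x ≠ b := by rintro rfl; exact hzb hzx
  refine ⟨x, ⟨hR.1 w hw b hb hwb' L hL hwL hbL hxL, mem_perp_insert.2
    ⟨⟨L, hL, hxL, hbL⟩, mem_perp_singleton.2 hzx.symm⟩⟩, fun h => hwy ?_⟩
  exact (collinear_of_mem_line L hL y x hxL b hbL hxb h hyb w hwL).symm

theorem IsNondegenerate.exists_mem_perp_not_collinear {R N : Set P} {p : P}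
    (hR : G.IsNondegenerate R) (hN : G.IsSingular N) (hNR : N ⊆ R) (hp : p ∈ R)
    (hpN : p ∈ G.residue N) : ∃ q ∈ R, q ∈ G.perp N ∧ ¬ G.Collinear q p := by
  induction hN using IsSingular.induction generalizing R p with
  | empty =>
    obtain ⟨q, hq, hpq⟩ := hR.2 p hp
    exact ⟨q, hq, by simp only [perp, Set.mem_empty_iff_false, false_imp_iff, implies_true,
      Set.mem_ofPred_eq], fun h => hpq h.symm⟩
  | adjoin N b _ hb ih =>
    have hbR := hNR (mem_adjoin N b)
    have hN0 : N ⊆ G.adjoin N b := subset_adjoin N b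
    obtain ⟨z, _, hzN, hzb⟩ := ih hR (hN0.trans hNR) hbR hb
    have hpb : p ≠ b := by rintro rfl; exact hpN.2 (mem_adjoin N _)
    obtain ⟨L, hL, hpL, hbL⟩ := hpN.1 b (mem_adjoin N b)
    obtain ⟨y, hyL, hzy⟩ := exists_collinear L hL z
    have hyb : y ≠ b := by rintro rfl; exact hzb hzy
    have hyR : y ∈ R := hR.1 p hp b hbR hpb L hL hpL hbL hyL
    have hyN : y ∈ G.residue N :=
      ⟨isSubspace_perp N p (perp_anti hN0 hpN.1) b hb.1 hpb L hL hpL hbL hyL, fun h => hpN.2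
        (isSubspace_adjoin N b y (hN0 h) b (mem_adjoin N b) hyb L hL hyL hbL hpL)⟩
    obtain ⟨w, ⟨hw, hwbz⟩, hwN, hwy⟩ := ih (hR.inter_perp_pair hbR hzb)
      (fun x hx => ⟨hNR (hN0 hx), mem_perp_insert.2 ⟨(hb.1 x hx).symm,
        mem_perp_singleton.2 (hzN x hx).symm⟩⟩)
      ⟨hyR, mem_perp_insert.2 ⟨⟨L, hL, hyL, hbL⟩, mem_perp_singleton.2 hzy.symm⟩⟩ hyN
    have hwb := (mem_perp_insert.1 hwbz).1
    exact ⟨w, hw, mem_perp_adjoin.2 ⟨hwb, hwN⟩, fun h => hwy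
      (collinear_of_mem_line L hL w p hpL b hbL hpb h hwb y hyL)⟩

theorem exists_mem_residue_not_collinear {N : Set P} {p : P} (hN : G.IsSingular N)
    (hp : p ∈ G.residue N) : ∃ q ∈ G.residue N, ¬ G.Collinear q p := by
  obtain ⟨q, -, hq, hqp⟩ := isNondegenerate_univ.exists_mem_perp_not_collinear hN
    (Set.subset_univ N) trivial hp
  exact ⟨q, ⟨hq, fun h => hqp (hp.1 q h).symm⟩, hqp⟩

theorem exists_adjoin_inter_perp_subset {N : Set P} {p : P} (hN : G.IsSingular N)
    (hp : p ∈ G.residue N) : ∃ q, G.adjoin N p ∩ G.perp {q} ⊆ N := by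
  obtain ⟨q, hq, hqp⟩ := exists_mem_residue_not_collinear hN hp
  refine ⟨q, fun x ⟨hx, hxq⟩ => ?_⟩
  by_contra hxN
  have hS := isSingular_adjoin hN hp.1
  have hpx := hS.subset_perp hx p (mem_adjoin N p)
  obtain ⟨w, ⟨-, hwpq⟩, hwN, hwx⟩ :=
    (isNondegenerate_univ.inter_perp_pair trivial hqp).exists_mem_perp_not_collinear hN
      (fun y hy => ⟨trivial, mem_perp_insert.2 ⟨(hp.1 y hy).symm,
        mem_perp_singleton.2 (hq.1 y hy).symm⟩⟩)
      ⟨trivial, mem_perp_insert.2 ⟨hpx, hxq⟩⟩ (hS.mem_residue (subset_adjoin N p) hx hxN)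
  exact hwx (mem_perp_adjoin.2 ⟨(mem_perp_insert.1 hwpq).1, hwN⟩ x hx)

theorem exists_mem_line_of_subset_adjoin {N : Set P} {p : P} (hN : G.IsSingular N)
    (hp : p ∈ G.residue N) {L : Set P} (hL : L ∈ G.lines) (h : L ⊆ G.adjoin N p) :
    ∃ x ∈ L, x ∈ N := by
  obtain ⟨q, hq⟩ := exists_adjoin_inter_perp_subset hN hp
  obtain ⟨x, hx, hqx⟩ := exists_collinear L hL q
  exact ⟨x, hx, hq ⟨h hx, mem_perp_singleton.2 hqx.symm⟩⟩

theorem adjoin_eq_of_mem {N : Set P} {p x : P} (hN : G.IsSingular N) (hp : p ∈ G.residue N)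
    (hx : x ∈ G.adjoin N p) (hxN : x ∉ N) : G.adjoin N x = G.adjoin N p := by
  have := (isSingular_adjoin hN hp.1).adjoin_inter_eq
    (fun L hL h => exists_mem_line_of_subset_adjoin hN hp hL h) hx hxN
  rwa [Set.inter_eq_right.2 (subset_adjoin N p)] at this

theorem notMem_adjoin_comm {N : Set P} {p q : P} (hN : G.IsSingular N) (hp : p ∉ N)
    (hq : q ∈ G.residue N) (h : q ∉ G.adjoin N p) : p ∉ G.adjoin N q := fun h' =>
  h (adjoin_eq_of_mem hN hq h' hp ▸ mem_adjoin N q)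

theorem mem_of_mem_adjoin_of_not_collinear {N : Set P} {p x z : P} (hN : G.IsSingular N)
    (hp : p ∈ G.residue N) (hzN : z ∈ G.perp N) (hzp : ¬ G.Collinear z p)
    (hx : x ∈ G.adjoin N p) (hzx : G.Collinear z x) : x ∈ N := by
  by_contra hxN
  have hpx : p ∈ G.adjoin N x := adjoin_eq_of_mem hN hp hx hxN ▸ mem_adjoin N p
  exact hzp (mem_perp_adjoin.2 ⟨hzx, hzN⟩ p hpx)

end Separation

section Rank

variable [G.IsShultSpace]

theorem IsSingular.exists_finset {N : Set P} (hN : G.IsSingular N) :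
    ∃ X : Finset P, G.span (X : Set P) = N ∧ X.card = G.rk N := by
  classical
  suffices h : ∃ X : Finset P, G.span (X : Set P) = N by
    obtain ⟨X, hX⟩ := h
    exact Nat.sInf_mem (s := {m | ∃ X : Finset P, G.span (X : Set P) = N ∧ X.card = m})
      ⟨X.card, X, hX, rfl⟩
  induction hN using IsSingular.induction with
  | empty => exact ⟨∅, by rw [Finset.coe_empty, isSingular_empty.1.span_eq]⟩
  | adjoin _ p _ _ ih =>
    obtain ⟨X, rfl⟩ := ih
    exact ⟨insert p X, by rw [Finset.coe_insert, adjoin, span_insert_span]⟩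

/-- Generators of `⟨N, p⟩` are projected from one of them, `x ∉ N`, to the hyperplane `N`. -/
theorem exists_finset_card_lt {N : Set P} {p : P} (hN : G.IsSingular N) (hp : p ∈ G.residue N)
    {X : Finset P} (hX : G.span (X : Set P) = G.adjoin N p) :
    ∃ Y : Finset P, G.span (Y : Set P) = N ∧ Y.card < X.card := by
  classical
  have hXN : (X : Set P) ⊆ G.adjoin N p := hX ▸ subset_span _
  obtain ⟨x, hxX, hxN⟩ : ∃ x ∈ X, x ∉ N := by
    by_contra! h
    exact hp.2 (span_subset hN.1 h (hX ▸ mem_adjoin N p))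
  have hS := isSingular_adjoin hN hp.1
  have proj : ∀ y ∈ X.erase x, ∃ z ∈ N, y ∈ G.span {x, z} := by
    intro y hy
    obtain ⟨hyx, hyX⟩ := Finset.mem_erase.1 hy
    obtain ⟨L, hL, hyL, hxL⟩ := hS.2 y (hXN hyX) x (hXN hxX) hyx
    have hLS := hS.1 y (hXN hyX) x (hXN hxX) hyx L hL hyL hxL
    obtain ⟨z, hzL, hzN⟩ := exists_mem_line_of_subset_adjoin hN hp hL hLS
    exact ⟨z, hzN, isSubspace_span _ x (subset_span _ (by simp)) z (subset_span _ (by simp))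
      (ne_of_mem_of_not_mem hzN hxN).symm L hL hxL hzL hyL⟩
  choose! π hπN hπ using proj
  set M := G.span ((X.erase x).image π : Finset P) with hM
  have hMN : M ⊆ N := by
    refine span_subset hN.1 ?_
    rw [Finset.coe_image, Set.image_subset_iff]
    exact hπN
  have hMS : G.IsSingular M := isSingular_span <| (subset_span _).trans <|
    (hMN.trans hN.subset_perp).trans (perp_anti ((subset_span _).trans hMN))
  have hxM : x ∈ G.residue M := hS.mem_residue (hMN.trans (subset_adjoin N p)) (hXN hxX)
    fun h => hxN (hMN h)
  have hXM : (X : Set P) ⊆ G.adjoin M x := by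
    intro y hy
    obtain rfl | hyx := eq_or_ne y x
    · exact mem_adjoin M y
    have hy' := Finset.mem_erase.2 ⟨hyx, hy⟩
    refine span_mono (Set.insert_subset_insert (Set.singleton_subset_iff.2 ?_)) (hπ y hy')
    exact subset_span _ (Finset.mem_coe.2 (Finset.mem_image_of_mem π hy'))
  refine ⟨(X.erase x).image π, hMN.antisymm fun w hw => ?_,
    Finset.card_image_le.trans_lt (Finset.card_erase_lt_of_mem hxX)⟩
  by_contra hwM
  have hwx : w ∈ G.adjoin M x :=
    span_subset (isSubspace_adjoin M x) hXM (hX ▸ subset_adjoin N p hw)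
  exact hxN (adjoin_subset hN.1 hMN hw (adjoin_eq_of_mem hMS hxM hwx hwM ▸ mem_adjoin M x))

theorem rk_adjoin {N : Set P} {p : P} (hN : G.IsSingular N) (hp : p ∈ G.residue N) :
    G.rk (G.adjoin N p) = G.rk N + 1 := by
  classical
  refine le_antisymm ?_ ?_
  · obtain ⟨X, rfl, hXr⟩ := hN.exists_finset
    rw [← hXr, adjoin, span_insert_span, ← Finset.coe_insert]
    exact (rk_le_card _).trans (Finset.card_insert_le p X)
  · obtain ⟨X, hX, hXr⟩ := (isSingular_adjoin hN hp.1).exists_finset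
    obtain ⟨Y, rfl, hYX⟩ := exists_finset_card_lt hN hp hX
    exact (Nat.succ_le_succ (rk_le_card Y)).trans (hXr ▸ hYX)

theorem IsSingular.rk_le_rk_inter_succ {X H : Set P} (hX : G.IsSingular X) (hH : G.IsSubspace H)
    (h : ∀ L ∈ G.lines, L ⊆ X → ∃ x ∈ L, x ∈ H) : G.rk X ≤ G.rk (X ∩ H) + 1 := by
  by_cases hXH : X ⊆ H
  · rw [Set.inter_eq_left.2 hXH]
    exact Nat.le_succ _
  obtain ⟨x, hx, hxH⟩ := Set.not_subset.1 hXH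
  rw [← rk_adjoin (hX.inter hH) (hX.mem_residue Set.inter_subset_left hx fun h => hxH h.2),
    hX.adjoin_inter_eq h hx hxH]

theorem IsSingular.rk_le_rk_inter_perp {Y : Set P} (hY : G.IsSingular Y) (p : P) :
    G.rk Y ≤ G.rk (Y ∩ G.perp {p}) + 1 := by
  refine hY.rk_le_rk_inter_succ (isSubspace_perp _) fun L hL _ => ?_
  obtain ⟨q, hq, hpq⟩ := exists_collinear L hL p
  exact ⟨q, hq, mem_perp_singleton.2 hpq.symm⟩

theorem IsSingular.rk_le_and_subset_of_rk_le {M N : Set P} (hM : G.IsSingular M)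
    (hN : G.IsSingular N) (h : M ⊆ N) : G.rk M ≤ G.rk N ∧ (G.rk N ≤ G.rk M → N ⊆ M) := by
  induction hN using IsSingular.induction generalizing M with
  | empty =>
    rw [Set.subset_empty_iff.1 h]
    exact ⟨le_rfl, fun _ => subset_rfl⟩
  | adjoin N p hN hp ih =>
    obtain ⟨hle, hsub⟩ := ih (hM.inter hN.1) Set.inter_subset_right
    have hr := hM.rk_le_rk_inter_succ hN.1 fun L hL hLM =>
      exists_mem_line_of_subset_adjoin hN hp hL (hLM.trans h)
    rw [rk_adjoin hN hp]
    refine ⟨by lia, fun hNM => ?_⟩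
    have hNM' : N ⊆ M := (hsub (by lia)).trans Set.inter_subset_left
    obtain ⟨x, hxM, hxN⟩ : ∃ x ∈ M, x ∉ N := by
      by_contra! hMN'
      rw [hNM'.antisymm hMN'] at hNM
      lia
    rw [← adjoin_eq_of_mem hN hp (h hxM) hxN]
    exact adjoin_subset hM.1 hNM' hxM

theorem IsSingular.rk_mono {M N : Set P} (hM : G.IsSingular M) (hN : G.IsSingular N)
    (h : M ⊆ N) : G.rk M ≤ G.rk N :=
  (hM.rk_le_and_subset_of_rk_le hN h).1

theorem IsSingular.eq_of_subset_of_rk_le {M N : Set P} (hM : G.IsSingular M)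
    (hN : G.IsSingular N) (h : M ⊆ N) (hr : G.rk N ≤ G.rk M) : M = N :=
  h.antisymm ((hM.rk_le_and_subset_of_rk_le hN h).2 hr)

theorem IsSingular.hasDim_iff {N : Set P} (hN : G.IsSingular N) {d : ℤ} :
    G.HasDim N d ↔ (G.rk N : ℤ) = d + 1 := by
  have key : G.HasDim N ((G.rk N : ℤ) - 1) := by
    obtain ⟨X, hX, hXr⟩ := hN.exists_finset
    refine ⟨⟨X, hX, by rw [hXr]⟩, ?_⟩
    rintro _ ⟨Y, rfl, rfl⟩
    have := G.rk_le_card Y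
    lia
  constructor
  · intro h
    have := h.unique key
    lia
  · intro h
    rwa [show d = (G.rk N : ℤ) - 1 by lia]

end Rank

section Flats

variable [G.IsShultSpace]

theorem mem_grassmannian_iff {N : Set P} {d : ℤ} :
    N ∈ G.grassmannian d ↔ G.IsSingular N ∧ (G.rk N : ℤ) = d + 1 :=
  and_congr_right fun h => h.hasDim_iff

theorem mem_grassmannian_natCast {N : Set P} {k : ℕ} :
    N ∈ G.grassmannian k ↔ N ∈ G.flats (k + 1) := by
  rw [mem_grassmannian_iff, flats, Set.mem_ofPred_eq]
  norm_cast

theorem adjoin_mem_flats {N : Set P} {m : ℕ} {p : P} (hN : N ∈ G.flats m)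
    (hp : p ∈ G.residue N) : G.adjoin N p ∈ G.flats (m + 1) :=
  ⟨isSingular_adjoin hN.1 hp.1, by rw [rk_adjoin hN.1 hp, hN.2]⟩

theorem eq_of_mem_flats {X Y : Set P} {m : ℕ} (hX : X ∈ G.flats m) (hY : Y ∈ G.flats m)
    (h : X ⊆ Y) : X = Y :=
  hX.1.eq_of_subset_of_rk_le hY.1 h (hY.2.trans hX.2.symm).le

theorem IsSingular.exists_mem_notMem {H X : Set P} (hX : G.IsSingular X) (hH : G.IsSingular H)
    (hr : G.rk H < G.rk X) : ∃ p ∈ X, p ∉ H :=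
  Set.not_subset.1 fun h => (hX.rk_mono hH h).not_gt hr

theorem adjoin_eq_of_mem_flats {H X : Set P} {m : ℕ} {p : P} (hH : H ∈ G.flats m)
    (hX : X ∈ G.flats (m + 1)) (hHX : H ⊆ X) (hp : p ∈ X) (hpH : p ∉ H) : G.adjoin H p = X :=
  eq_of_mem_flats (adjoin_mem_flats hH (hX.1.mem_residue hHX hp hpH)) hX
    (adjoin_subset hX.1.1 hHX hp)

theorem exists_adjoin_eq {H X : Set P} {m : ℕ} (hH : H ∈ G.flats m) (hX : X ∈ G.flats (m + 1))
    (hHX : H ⊆ X) : ∃ p ∈ G.residue H, G.adjoin H p = X := by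
  obtain ⟨p, hp, hpH⟩ := hX.1.exists_mem_notMem hH.1 (by rw [hH.2, hX.2]; exact Nat.lt_succ_self m)
  exact ⟨p, hX.1.mem_residue hHX hp hpH, adjoin_eq_of_mem_flats hH hX hHX hp hpH⟩

theorem rk_le_rk_inter_hyperplane {H X Y : Set P} {m : ℕ} (hH : H ∈ G.flats m)
    (hX : X ∈ G.flats (m + 1)) (hHX : H ⊆ X) (hY : G.IsSingular Y) (hYX : Y ⊆ X) :
    G.rk Y ≤ G.rk (Y ∩ H) + 1 := by
  obtain ⟨p, hp, rfl⟩ := exists_adjoin_eq hH hX hHX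
  exact hY.rk_le_rk_inter_succ hH.1.1 fun L hL h =>
    exists_mem_line_of_subset_adjoin hH.1 hp hL (h.trans hYX)

theorem exists_hyperplane {Q Y : Set P} {m : ℕ} (hQ : G.IsSingular Q) (hY : Y ∈ G.flats (m + 1))
    (hQY : Q ⊆ Y) (hr : G.rk Q ≤ m) : ∃ H ∈ G.flats m, Q ⊆ H ∧ H ⊆ Y := by
  obtain ⟨H, hQH, ⟨hH, hHY, hne⟩, hmax⟩ :=
    exists_maximal (p := fun S => G.IsSingular S ∧ S ⊆ Y ∧ S ≠ Y) (fun S hS => hS.1)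
      ⟨hQ, hQY, by rintro rfl; exact (hY.2 ▸ hr).not_gt (Nat.lt_succ_self m)⟩
  obtain ⟨p, hp, hpH⟩ := Set.exists_of_ssubset (hHY.ssubset_of_ne hne)
  have hpr := hY.1.mem_residue hHY hp hpH
  have hHp : G.adjoin H p = Y := by
    by_contra h
    exact hpH (hmax ⟨isSingular_adjoin hH hpr.1, adjoin_subset hY.1.1 hHY hp, h⟩
      (subset_adjoin H p) (mem_adjoin H p))
  refine ⟨H, ⟨hH, ?_⟩, hQH, hHY⟩
  have := hHp ▸ rk_adjoin hH hpr
  exact Nat.succ_injective (this.symm.trans hY.2)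

theorem rk_le_rk_inter_perp_add {W Q Y : Set P} {m d : ℕ} (hW : G.IsSingular W)
    (hQ : Q ∈ G.flats m) (hWQ : W ⊆ G.perp Q) (hY : Y ∈ G.flats (m + d)) (hQY : Q ⊆ Y) :
    G.rk W ≤ G.rk (W ∩ G.perp Y) + d := by
  induction d generalizing Y with
  | zero =>
    rw [← eq_of_mem_flats hQ hY hQY, Set.inter_eq_left.2 hWQ]
    exact le_rfl
  | succ d ih =>
    obtain ⟨H, hH, hQH, hHY⟩ := exists_hyperplane hQ.1 hY hQY (hQ.2.trans_le (Nat.le_add_right m d))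
    obtain ⟨p, _, rfl⟩ := exists_adjoin_eq hH hY hHY
    have hWH := hW.inter (isSubspace_perp H)
    have hcut : W ∩ G.perp H ∩ G.perp {p} ⊆ W ∩ G.perp (G.adjoin H p) := fun x ⟨⟨hxW, hxH⟩, hxp⟩ =>
      ⟨hxW, mem_perp_adjoin.2 ⟨mem_perp_singleton.1 hxp, hxH⟩⟩
    calc G.rk W ≤ G.rk (W ∩ G.perp H) + d := ih hH hQH
      _ ≤ G.rk (W ∩ G.perp H ∩ G.perp {p}) + 1 + d := by gcongr; exact hWH.rk_le_rk_inter_perp p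
      _ ≤ G.rk (W ∩ G.perp (G.adjoin H p)) + 1 + d := by
        gcongr
        exact (hWH.inter (isSubspace_perp _)).rk_mono (hW.inter (isSubspace_perp _)) hcut
      _ = G.rk (W ∩ G.perp (G.adjoin H p)) + (d + 1) := by ring

theorem HasRank.exists_flat_superset {n : ℕ} (hn : G.HasRank n) {X : Set P}
    (hX : G.IsSingular X) : ∃ M ∈ G.flats n, X ⊆ M := by
  obtain ⟨M, hXM, hM⟩ := exists_maximal (fun _ => id) hX
  have := hM.1.hasDim_iff.1 (hn M hM)
  exact ⟨M, ⟨hM.1, by lia⟩, hXM⟩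

theorem HasRank.rk_le {n : ℕ} (hn : G.HasRank n) {X : Set P} (hX : G.IsSingular X) :
    G.rk X ≤ n := by
  obtain ⟨M, hM, hXM⟩ := hn.exists_flat_superset hX
  exact hM.2 ▸ hX.rk_mono hM.1 hXM

theorem HasRank.exists_mem_residue {n : ℕ} (hn : G.HasRank n) {X : Set P}
    (hX : G.IsSingular X) (hr : G.rk X < n) : ∃ p, p ∈ G.residue X := by
  obtain ⟨M, hM, hXM⟩ := hn.exists_flat_superset hX
  obtain ⟨p, hp, hpX⟩ := hM.1.exists_mem_notMem hX (hM.2.symm ▸ hr)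
  exact ⟨p, hM.1.mem_residue hXM hp hpX⟩

end Flats

section Residue

variable [G.IsShultSpace]

theorem HasRank.exists_common_neighbor {n m : ℕ} (hn : G.HasRank n) {N : Set P}
    (hN : N ∈ G.flats m) (hm : m + 2 ≤ n) {c d : P} (hc : c ∈ G.residue N)
    (hd : d ∈ G.residue N) (hcd : ¬ G.Collinear c d) :
    ∃ e ∈ G.residue N, G.Collinear e c ∧ G.Collinear e d ∧ e ∉ G.adjoin N c ∧
      e ∉ G.adjoin N d := by
  have hNd := adjoin_mem_flats hN hd
  obtain ⟨u, hu⟩ := hn.exists_mem_residue hNd.1 (by rw [hNd.2]; lia)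
  have hud : u ≠ d := by rintro rfl; exact hu.2 (mem_adjoin N _)
  obtain ⟨L, hL, huL, hdL⟩ := hu.1 d (mem_adjoin N d)
  obtain ⟨e, heL, hce⟩ := IsShultSpace.exists_collinear L hL c
  have hed : e ≠ d := by rintro rfl; exact hcd hce
  have hedc : G.Collinear e d := ⟨L, hL, heL, hdL⟩
  have heNd : e ∉ G.adjoin N d := fun h =>
    hu.2 (hNd.1.1 e h d (mem_adjoin N d) hed L hL heL hdL huL)
  have heN : e ∈ G.residue N := ⟨isSubspace_perp N u (residue_anti (subset_adjoin N d) hu).1 d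
    hd.1 hud L hL huL hdL heL, fun h => heNd (subset_adjoin N d h)⟩
  refine ⟨e, heN, hce.symm, hedc, fun h => hcd ?_, heNd⟩
  have hce' : c ∈ G.adjoin N e := adjoin_eq_of_mem hN.1 hc h heN.2 ▸ mem_adjoin N c
  exact ((mem_perp_adjoin (p := e)).2 ⟨hedc.symm, hd.1⟩ c hce').symm

/-- This says that the residue of `N` is connected. -/
theorem HasRank.residue_induction {n m : ℕ} (hn : G.HasRank n) {N : Set P} (hN : N ∈ G.flats m)
    (hm : m + 2 ≤ n) {T : P → Prop}
    (step : ∀ c ∈ G.residue N, ∀ d ∈ G.residue N, G.Collinear c d → d ∉ G.adjoin N c →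
      T c → T d) {c d : P} (hc : c ∈ G.residue N) (hd : d ∈ G.residue N) (h : T c) : T d := by
  by_cases hcd : G.Collinear c d
  · by_cases hdc : d ∈ G.adjoin N c
    · have hNc := adjoin_mem_flats hN hc
      obtain ⟨e, he⟩ := hn.exists_mem_residue hNc.1 (by rw [hNc.2]; lia)
      have heN := residue_anti (subset_adjoin N c) he
      refine step e heN d hd (he.1 d hdc) (notMem_adjoin_comm hN.1 hd.2 heN ?_)
        (step c hc e heN (he.1 c (mem_adjoin N c)).symm he.2 h)
      rw [adjoin_eq_of_mem hN.1 hc hdc hd.2]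
      exact he.2
    · exact step c hc d hd hcd hdc h
  · obtain ⟨e, he, hec, hed, hec', hed'⟩ := hn.exists_common_neighbor hN hm hc hd hcd
    exact step e he d hd hed (notMem_adjoin_comm hN.1 hd.2 he hed') (step c hc e he hec.symm hec' h)

end Residue

section Opposite

/-- The singular subspaces `X` and `Y` of rank `m` meet in `Q` and are opposite in the residue
of `Q`: no point of one of them outside `Q` is collinear to all points of the other. -/
structure OppositeOver (G : PointLineGeometry P) (Q : Set P) (m : ℕ) (X Y : Set P) : Prop where
  left : X ∈ G.flats m
  right : Y ∈ G.flats m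
  subset_left : Q ⊆ X
  subset_right : Q ⊆ Y
  inter_perp_left : X ∩ G.perp Y ⊆ Q
  inter_perp_right : Y ∩ G.perp X ⊆ Q

variable {Q X Y : Set P} {m n : ℕ}

theorem OppositeOver.symm (h : G.OppositeOver Q m X Y) : G.OppositeOver Q m Y X :=
  ⟨h.right, h.left, h.subset_right, h.subset_left, h.inter_perp_right, h.inter_perp_left⟩

theorem oppositeOver_self (hQ : Q ∈ G.flats m) : G.OppositeOver Q m Q Q :=
  ⟨hQ, hQ, subset_rfl, subset_rfl, Set.inter_subset_left, Set.inter_subset_left⟩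

variable [G.IsShultSpace]

theorem OppositeOver.inter_eq (h : G.OppositeOver Q m X Y) : X ∩ Y = Q :=
  Set.Subset.antisymm (fun _ hx => h.inter_perp_left ⟨hx.1, h.right.1.subset_perp hx.2⟩)
    (Set.subset_inter h.subset_left h.subset_right)

theorem OppositeOver.isSingular (h : G.OppositeOver Q m X Y) : G.IsSingular Q :=
  h.inter_eq ▸ h.left.1.inter h.right.1.1

theorem adjoin_inter_perp_adjoin_subset {x y : P} (hX : G.IsSingular X) (h : X ∩ G.perp Y ⊆ Q)
    (hx : x ∈ G.residue X) (hy : y ∈ G.perp X) (hyx : ¬ G.Collinear y x) :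
    G.adjoin X x ∩ G.perp (G.adjoin Y y) ⊆ Q := fun _ ⟨hv, hv'⟩ =>
  h ⟨mem_of_mem_adjoin_of_not_collinear hX hx hy hyx hv (hv' y (mem_adjoin Y y)).symm,
    perp_anti (subset_adjoin Y y) hv'⟩

theorem OppositeOver.adjoin {x y : P} (h : G.OppositeOver Q m X Y) (hx : x ∈ G.residue X)
    (hxY : x ∈ G.perp Y) (hy : y ∈ G.residue Y) (hyX : y ∈ G.perp X) (hxy : ¬ G.Collinear x y) :
    G.OppositeOver Q (m + 1) (G.adjoin X x) (G.adjoin Y y) where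
  left := adjoin_mem_flats h.left hx
  right := adjoin_mem_flats h.right hy
  subset_left := h.subset_left.trans (subset_adjoin X x)
  subset_right := h.subset_right.trans (subset_adjoin Y y)
  inter_perp_left := adjoin_inter_perp_adjoin_subset h.left.1 h.inter_perp_left hx hyX
    (mt Collinear.symm hxy)
  inter_perp_right := adjoin_inter_perp_adjoin_subset h.right.1 h.inter_perp_right hy hxY hxy

theorem OppositeOver.exists_adjoin_perp {p : P} (h : G.OppositeOver Q m X Y)
    (hp : p ∈ G.residue X) : ∃ x ∈ G.residue X, x ∈ G.adjoin X p ∧ x ∈ G.perp Y := by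
  have hW := adjoin_mem_flats h.left hp
  have hQY : G.rk Q ≤ m := h.right.2 ▸ h.isSingular.rk_mono h.right.1 h.subset_right
  have hcut := rk_le_rk_inter_perp_add (d := m - G.rk Q) hW.1 ⟨h.isSingular, rfl⟩
    (hW.1.subset_perp.trans (perp_anti (h.subset_left.trans (subset_adjoin X p))))
    (by rw [Nat.add_sub_cancel' hQY]; exact h.right) h.subset_right
  obtain ⟨x, ⟨hxp, hxY⟩, hxQ⟩ := (hW.1.inter (isSubspace_perp Y)).exists_mem_notMem h.isSingular
    (by rw [hW.2] at hcut; lia)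
  exact ⟨x, hW.1.mem_residue (subset_adjoin X p) hxp fun hxX => hxQ (h.inter_perp_left ⟨hxX, hxY⟩),
    hxp, hxY⟩

theorem OppositeOver.exists_succ (hn : G.HasRank n) (h : G.OppositeOver Q m X Y) (hm : m < n) :
    ∃ X' Y', G.OppositeOver Q (m + 1) X' Y' ∧ X ⊆ X' ∧ Y ⊆ Y' := by
  obtain ⟨p, hp⟩ := hn.exists_mem_residue h.left.1 (h.left.2.symm ▸ hm)
  obtain ⟨x, hx, -, hxY⟩ := h.exists_adjoin_perp hp
  have hxr : x ∈ G.residue Y :=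
    ⟨hxY, fun hxY' => hx.2 (h.subset_left (h.inter_perp_right ⟨hxY', hx.1⟩))⟩
  obtain ⟨q, hq, hqx⟩ := exists_mem_residue_not_collinear h.right.1 hxr
  obtain ⟨y, hy, hyq, hyX⟩ := h.symm.exists_adjoin_perp hq
  have hxy : ¬ G.Collinear x y := fun hxy => hy.2
    (mem_of_mem_adjoin_of_not_collinear h.right.1 hq hxY (mt Collinear.symm hqx) hyq hxy)
  exact ⟨_, _, h.adjoin hx hxY hy hyX hxy, subset_adjoin X x, subset_adjoin Y y⟩

theorem OppositeOver.exists_ge {K : ℕ} (hn : G.HasRank n) (h : G.OppositeOver Q m X Y)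
    (hmK : m ≤ K) (hK : K ≤ n) : ∃ X' Y', G.OppositeOver Q K X' Y' ∧ X ⊆ X' ∧ Y ⊆ Y' := by
  induction K, hmK using Nat.le_induction with
  | base => exact ⟨X, Y, h, subset_rfl, subset_rfl⟩
  | succ K _ ih =>
    obtain ⟨X₁, Y₁, h₁, hX₁, hY₁⟩ := ih (Nat.le_of_succ_le hK)
    obtain ⟨X₂, Y₂, h₂, hX₂, hY₂⟩ := h₁.exists_succ hn hK
    exact ⟨X₂, Y₂, h₂, hX₁.trans hX₂, hY₁.trans hY₂⟩

theorem exists_oppositeOver_of_collinear {r t : P} (hQ : Q ∈ G.flats m) (hr : r ∈ G.residue Q)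
    (ht : t ∈ G.residue Q) (htr : t ∉ G.adjoin Q r) (hc : G.Collinear t r) :
    ∃ X Y, G.OppositeOver Q (m + 2) X Y ∧ G.adjoin Q r ⊆ X ∧ G.adjoin Q t ⊆ Y := by
  have hR := adjoin_mem_flats hQ hr
  have hT := adjoin_mem_flats hQ ht
  have htR := mem_residue_adjoin ht hc htr
  have hrT := mem_residue_adjoin hr hc.symm (notMem_adjoin_comm hQ.1 hr.2 ht htr)
  obtain ⟨x, hx, hxt⟩ := exists_mem_residue_not_collinear hR.1 htR
  obtain ⟨y, hy, hyr⟩ := exists_mem_residue_not_collinear hT.1 hrT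
  have hQX := (subset_adjoin Q r).trans (subset_adjoin (G := G) (G.adjoin Q r) x)
  have hQY := (subset_adjoin Q t).trans (subset_adjoin (G := G) (G.adjoin Q t) y)
  refine ⟨_, _, ⟨adjoin_mem_flats hR hx, adjoin_mem_flats hT hy, hQX, hQY, ?_, ?_⟩,
    subset_adjoin _ x, subset_adjoin _ y⟩
  · rintro v ⟨hv, hv'⟩
    have hvR := mem_of_mem_adjoin_of_not_collinear hR.1 hx htR.1 (mt Collinear.symm hxt) hv
      (hv' t (subset_adjoin _ y (mem_adjoin Q t))).symm
    exact mem_of_mem_adjoin_of_not_collinear hQ.1 hr (perp_anti (subset_adjoin Q t) hy.1) hyr hvR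
      (hv' y (mem_adjoin _ y)).symm
  · rintro v ⟨hv, hv'⟩
    have hvT := mem_of_mem_adjoin_of_not_collinear hT.1 hy hrT.1 (mt Collinear.symm hyr) hv
      (hv' r (subset_adjoin _ x (mem_adjoin Q r))).symm
    exact mem_of_mem_adjoin_of_not_collinear hQ.1 ht (perp_anti (subset_adjoin Q r) hx.1) hxt hvT
      (hv' x (mem_adjoin _ x)).symm

theorem HasRank.exists_oppositeOver {K : ℕ} (hn : G.HasRank n) {r t : P} (hQ : Q ∈ G.flats m)
    (hr : r ∈ G.residue Q) (ht : t ∈ G.residue Q) (htr : t ∉ G.adjoin Q r) (hK : m + 2 ≤ K)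
    (hKn : K ≤ n) :
    ∃ X Y, G.OppositeOver Q K X Y ∧ G.adjoin Q r ⊆ X ∧ G.adjoin Q t ⊆ Y := by
  by_cases hc : G.Collinear t r
  · obtain ⟨X, Y, hXY, hrX, htY⟩ := exists_oppositeOver_of_collinear hQ hr ht htr hc
    obtain ⟨X', Y', hXY', hX, hY⟩ := hXY.exists_ge hn hK hKn
    exact ⟨X', Y', hXY', hrX.trans hX, htY.trans hY⟩
  · exact ((oppositeOver_self hQ).adjoin hr hr.1 ht ht.1 (mt Collinear.symm hc)).exists_ge hn
      (by lia) hKn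

end Opposite

section Neighbors

/-- The singular subspaces `X` and `Y` of rank `m + 1` are perpendicular and meet in a common
hyperplane. This is adjacency in the Grassmann graph of the subspaces of dimension `m`, unless
these are the maximal ones. -/
structure Neighbors (G : PointLineGeometry P) (m : ℕ) (X Y : Set P) : Prop where
  left : X ∈ G.flats (m + 1)
  right : Y ∈ G.flats (m + 1)
  inter : X ∩ Y ∈ G.flats m
  subset_perp : X ⊆ G.perp Y

variable {A B C D H X Y U Q : Set P} {m n : ℕ} {p q y : P}

theorem Neighbors.symm (h : G.Neighbors m X Y) : G.Neighbors m Y X :=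
  ⟨h.right, h.left, Set.inter_comm X Y ▸ h.inter, subset_perp_comm.1 h.subset_perp⟩

theorem Neighbors.ne (h : G.Neighbors m X Y) : X ≠ Y := by
  rintro rfl
  have hr := h.inter.2
  rw [Set.inter_self, h.left.2] at hr
  exact Nat.succ_ne_self m hr

variable [G.IsShultSpace]

theorem rk_inter_lt (hX : X ∈ G.flats m) (hY : G.IsSubspace Y) (h : ¬ X ⊆ Y) :
    G.rk (X ∩ Y) < m := by
  by_contra! hm
  exact h (Set.inter_eq_left.1 ((hX.1.inter hY).eq_of_subset_of_rk_le hX.1 Set.inter_subset_left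
    (hX.2.trans_le hm)))

theorem inter_eq_of_mem_flats (hH : H ∈ G.flats m) (hX : X ∈ G.flats (m + 1))
    (hY : Y ∈ G.flats (m + 1)) (hne : X ≠ Y) (hHX : H ⊆ X) (hHY : H ⊆ Y) : X ∩ Y = H := by
  refine Set.Subset.antisymm (fun p hp => ?_) (Set.subset_inter hHX hHY)
  by_contra hpH
  exact hne ((adjoin_eq_of_mem_flats hH hX hHX hp.1 hpH).symm.trans
    (adjoin_eq_of_mem_flats hH hY hHY hp.2 hpH))

theorem neighbors_of_hyperplane (hH : H ∈ G.flats m) (hX : X ∈ G.flats (m + 1))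
    (hY : Y ∈ G.flats (m + 1)) (hne : X ≠ Y) (hHX : H ⊆ X) (hHY : H ⊆ Y)
    (hXY : X ⊆ G.perp Y) : G.Neighbors m X Y :=
  ⟨hX, hY, (inter_eq_of_mem_flats hH hX hY hne hHX hHY).symm ▸ hH, hXY⟩

theorem neighbors_of_subset (hX : X ∈ G.flats (m + 1)) (hY : Y ∈ G.flats (m + 1))
    (hU : U ∈ G.flats (m + 2)) (hne : X ≠ Y) (hXU : X ⊆ U) (hYU : Y ⊆ U) :
    G.Neighbors m X Y := by
  have hI := hX.1.inter hY.1.1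
  have hXI := rk_le_rk_inter_hyperplane hY hU hYU hX.1 hXU
  have hlt := rk_inter_lt hX hY.1.1 fun h => hne (eq_of_mem_flats hX hY h)
  rw [hX.2] at hXI
  exact ⟨hX, hY, ⟨hI, by lia⟩, hXU.trans (hU.1.subset_perp.trans (perp_anti hYU))⟩

theorem neighbors_adjoin (hH : H ∈ G.flats m) (hX : X ∈ G.flats (m + 1)) (hHX : H ⊆ X)
    (hq : q ∈ G.residue X) : G.Neighbors m X (G.adjoin H q) := by
  have hqH : q ∈ G.residue H := residue_anti hHX hq
  refine neighbors_of_hyperplane hH hX (adjoin_mem_flats hH hqH)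
    (fun h => hq.2 (h ▸ mem_adjoin H q)) hHX (subset_adjoin H q) fun x hx => ?_
  exact mem_perp_adjoin.2 ⟨(hq.1 x hx).symm, perp_anti hHX (hX.1.subset_perp hx)⟩

theorem Neighbors.adjoin_inter_eq (h : G.Neighbors m X Y) (hy : y ∈ Y) (hyX : y ∉ X) :
    G.adjoin (X ∩ Y) y = Y :=
  adjoin_eq_of_mem_flats h.inter h.right Set.inter_subset_right hy fun hy => hyX hy.1

theorem Neighbors.span_union_mem_flats (h : G.Neighbors m X Y) :
    G.span (X ∪ Y) ∈ G.flats (m + 2) := by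
  obtain ⟨y, hy, hyX⟩ := Set.not_subset.1 fun hYX => h.ne (eq_of_mem_flats h.right h.left hYX).symm
  have hyr : y ∈ G.residue X := ⟨h.symm.subset_perp hy, hyX⟩
  have hXy := adjoin_mem_flats h.left hyr
  have hspan : G.span (X ∪ Y) = G.adjoin X y := by
    refine (span_subset hXy.1.1 (Set.union_subset (subset_adjoin X y) ?_)).antisymm
      (adjoin_subset (isSubspace_span _) (Set.subset_union_left.trans (subset_span _))
        (subset_span _ (Or.inr hy)))
    conv_lhs => rw [← h.adjoin_inter_eq hy hyX]
    exact adjoin_subset hXy.1.1 (Set.inter_subset_left.trans (subset_adjoin X y)) (mem_adjoin X y)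
  rwa [hspan]

theorem eq_span_union (hA : A ∈ G.flats (m + 1)) (hB : B ∈ G.flats (m + 1))
    (hU : U ∈ G.flats (m + 2)) (hne : A ≠ B) (hAU : A ⊆ U) (hBU : B ⊆ U) :
    U = G.span (A ∪ B) :=
  (eq_of_mem_flats (neighbors_of_subset hA hB hU hne hAU hBU).span_union_mem_flats hU
    (span_subset hU.1.1 (Set.union_subset hAU hBU))).symm

theorem Neighbors.inter_subset_or_subset_span (hAB : G.Neighbors m A B)
    (hAC : G.Neighbors m A C) (hBC : G.Neighbors m B C) :
    A ∩ B ⊆ C ∨ C ⊆ G.span (A ∪ B) := by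
  by_cases h : A ∩ C ⊆ B
  · rw [← eq_of_mem_flats hAC.inter hAB.inter (Set.subset_inter Set.inter_subset_left h)]
    exact Or.inl Set.inter_subset_right
  · obtain ⟨x, hx, hxB⟩ := Set.not_subset.1 h
    rw [← hBC.adjoin_inter_eq hx.2 hxB]
    exact Or.inr (adjoin_subset (isSubspace_span _) (Set.inter_subset_left.trans
      (Set.subset_union_right.trans (subset_span _))) (subset_span _ (Or.inl hx.1)))

theorem Neighbors.of_between (hAB : G.Neighbors m A B) (hAD : G.Neighbors m A D)
    (hBD : G.Neighbors m B D) (hC : C ∈ G.flats (m + 1)) (hIC : A ∩ B ⊆ C)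
    (hCU : C ⊆ G.span (A ∪ B)) (hCD : C ≠ D) : G.Neighbors m C D := by
  rcases hAB.inter_subset_or_subset_span hAD hBD with hID | hDU
  · have hDU : D ⊆ G.perp (G.span (A ∪ B)) := by
      rw [perp_span]
      exact fun d hd x hx =>
        hx.elim (hAD.symm.subset_perp hd x) (hBD.symm.subset_perp hd x)
    exact neighbors_of_hyperplane hAB.inter hC hAD.right hCD hIC hID
      (subset_perp_comm.1 (hDU.trans (perp_anti hCU)))
  · exact neighbors_of_subset hC hAD.right hAB.span_union_mem_flats hCD hCU hDU

theorem Neighbors.inter_subset_of_subset_span (hAB : G.Neighbors m A B)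
    (hCD : G.Neighbors m C D) (hCU : C ⊆ G.span (A ∪ B)) (hID : A ∩ B ⊆ D)
    (hDU : ¬ D ⊆ G.span (A ∪ B)) : A ∩ B ⊆ C := by
  have hU := hAB.span_union_mem_flats
  have hIU : A ∩ B ⊆ G.span (A ∪ B) :=
    Set.inter_subset_left.trans (Set.subset_union_left.trans (subset_span _))
  have hDI : D ∩ G.span (A ∪ B) ⊆ A ∩ B := fun x hx => by
    by_contra hxI
    exact hDU (adjoin_eq_of_mem_flats hAB.inter hCD.right hID hx.1 hxI ▸
      adjoin_subset hU.1.1 hIU hx.2)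
  have hI : C ∩ D = A ∩ B :=
    eq_of_mem_flats hCD.inter hAB.inter fun x hx => hDI ⟨hx.2, hCU hx.1⟩
  exact hI ▸ Set.inter_subset_left

end Neighbors

section Distance

variable [G.IsShultSpace] {X Y Q : Set P} {m n k : ℕ} {p q y : P}

theorem adj_iff_neighbors (hk : k + 2 ≤ n) (X Y : G.grassmannian k) :
    (G.grassmannGraph n k).Adj X Y ↔ G.Neighbors k X.1 Y.1 := by
  have hX := mem_grassmannian_natCast.1 X.2
  have hY := mem_grassmannian_natCast.1 Y.2
  constructor
  · rintro ⟨hne, ⟨-, U, hU, hXU, hYU⟩ | ⟨h, -⟩⟩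
    · exact neighbors_of_subset hX hY (mem_grassmannian_natCast.1 hU)
        (Subtype.coe_injective.ne hne) hXU hYU
    · lia
  · intro h
    exact ⟨fun e => h.ne (congrArg _ e), Or.inl ⟨by lia, _,
      mem_grassmannian_natCast.2 h.span_union_mem_flats,
      Set.subset_union_left.trans (subset_span _), Set.subset_union_right.trans (subset_span _)⟩⟩

theorem Neighbors.edist_le_succ {X X' Y : G.grassmannian k} {e : ℕ} (hk : k + 2 ≤ n)
    (h : G.Neighbors k X.1 X'.1) (h' : (G.grassmannGraph n k).edist X' Y ≤ e) :
    (G.grassmannGraph n k).edist X Y ≤ (e + 1 : ℕ) :=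
  calc (G.grassmannGraph n k).edist X Y
      ≤ (G.grassmannGraph n k).edist X X' + (G.grassmannGraph n k).edist X' Y :=
        SimpleGraph.edist_triangle
    _ ≤ 1 + e := add_le_add
        (SimpleGraph.edist_eq_one_iff_adj.2 ((adj_iff_neighbors hk X X').2 h)).le h'
    _ = (e + 1 : ℕ) := by push_cast; ring

theorem exists_mem_residue_comm (hX : X ∈ G.flats m) (hY : Y ∈ G.flats m) (hqY : q ∈ Y)
    (hq : q ∈ G.residue X) : ∃ p ∈ X, p ∈ G.residue Y := by
  have hI := hX.1.inter hY.1.1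
  have hqI : q ∈ G.residue (X ∩ Y) := residue_anti Set.inter_subset_left hq
  have hQ := adjoin_mem_flats ⟨hI, rfl⟩ hqI
  have hQY : G.adjoin (X ∩ Y) q ⊆ Y := adjoin_subset hY.1.1 Set.inter_subset_right hqY
  have hle := hQ.2 ▸ hY.2 ▸ hQ.1.rk_mono hY.1 hQY
  have hcut := rk_le_rk_inter_perp_add (d := m - (G.rk (X ∩ Y) + 1)) hX.1 hQ
    (fun x hx => mem_perp_adjoin.2
      ⟨(hq.1 x hx).symm, perp_anti Set.inter_subset_left (hX.1.subset_perp hx)⟩)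
    (by rwa [Nat.add_sub_cancel' hle]) hQY
  obtain ⟨p, ⟨hpX, hpY⟩, hpI⟩ := (hX.1.inter (isSubspace_perp Y)).exists_mem_notMem hI
    (by rw [hX.2] at hcut; lia)
  exact ⟨p, hpX, hpY, fun h => hpI ⟨hpX, h⟩⟩

theorem exists_neighbor_of_mem_residue (hX : X ∈ G.flats (m + 1)) (hY : Y ∈ G.flats (m + 1))
    (hr : G.rk (X ∩ Y) < m) (hpX : p ∈ X) (hp : p ∈ G.residue Y) :
    ∃ X', G.Neighbors m X X' ∧ p ∈ X' ∧ G.rk (X ∩ Y) < G.rk (X' ∩ Y) := by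
  obtain ⟨q, hqY, hq⟩ := exists_mem_residue_comm hY hX hpX hp
  have hI := hX.1.inter hY.1.1
  have hpI : p ∈ G.residue (X ∩ Y) := residue_anti Set.inter_subset_right hp
  have hQ := adjoin_mem_flats ⟨hI, rfl⟩ hpI
  obtain ⟨H, hH, hQH, hHX⟩ := exists_hyperplane hQ.1 hX
    (adjoin_subset hX.1.1 Set.inter_subset_left hpX) (hQ.2.trans_le hr)
  have hXX' := neighbors_adjoin hH hX hHX hq
  have hqI : q ∈ G.residue (X ∩ Y) := residue_anti Set.inter_subset_left hq
  refine ⟨_, hXX', subset_adjoin H q (hQH (mem_adjoin _ p)), ?_⟩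
  rw [← Nat.succ_le_iff, Nat.succ_eq_add_one, ← rk_adjoin hI hqI]
  refine (isSingular_adjoin hI hqI.1).rk_mono (hXX'.right.1.inter hY.1.1) (Set.subset_inter ?_ ?_)
  · exact adjoin_subset (isSubspace_adjoin H q)
      ((subset_adjoin _ p).trans (hQH.trans (subset_adjoin H q))) (mem_adjoin H q)
  · exact adjoin_subset hY.1.1 Set.inter_subset_right hqY

theorem neighbors_of_mem_residue (hX : X ∈ G.flats (m + 1)) (hY : Y ∈ G.flats (m + 1))
    (hI : X ∩ Y ∈ G.flats m) (hpX : p ∈ X) (hp : p ∈ G.residue Y) : G.Neighbors m X Y := by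
  have h := neighbors_adjoin hI hY Set.inter_subset_right hp
  rw [adjoin_eq_of_mem_flats hI hX Set.inter_subset_left hpX fun h => hp.2 h.2] at h
  exact h.symm

theorem edist_le_of_mem_residue {X Y : G.grassmannian k} {e : ℕ} (hk : k + 2 ≤ n)
    (hpX : p ∈ X.1) (hp : p ∈ G.residue Y.1) (he : k + 1 ≤ G.rk (X.1 ∩ Y.1) + e) :
    (G.grassmannGraph n k).edist X Y ≤ e := by
  have hY := mem_grassmannian_natCast.1 Y.2
  induction e generalizing X with
  | zero =>
    exact absurd he (rk_inter_lt (mem_grassmannian_natCast.1 X.2) hY.1.1 fun h =>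
      hp.2 (h hpX)).not_ge
  | succ e ih =>
    have hX := mem_grassmannian_natCast.1 X.2
    have hI := hX.1.inter hY.1.1
    rcases lt_or_ge (G.rk (X.1 ∩ Y.1)) k with hlt | hge
    · obtain ⟨X', hXX', hpX', hr⟩ := exists_neighbor_of_mem_residue hX hY hlt hpX hp
      exact hXX'.edist_le_succ (X' := ⟨X', mem_grassmannian_natCast.2 hXX'.right⟩) hk
        (ih hpX' (by lia))
    · have hlt := rk_inter_lt hX hY.1.1 fun h => hp.2 (h hpX)
      have hXY := neighbors_of_mem_residue hX hY ⟨hI, by lia⟩ hpX hp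
      calc (G.grassmannGraph n k).edist X Y
          = 1 := SimpleGraph.edist_eq_one_iff_adj.2 ((adj_iff_neighbors hk X Y).2 hXY)
        _ ≤ (e + 1 : ℕ) := by exact_mod_cast Nat.le_add_left 1 e

theorem exists_neighbor_of_not_collinear (hn : G.HasRank n) (hm : m + 2 ≤ n)
    (hX : X ∈ G.flats (m + 1)) (hy : y ∉ G.perp X) :
    ∃ X', G.Neighbors m X X' ∧ X ∩ G.perp {y} ⊆ X' ∧ y ∈ G.residue X' := by
  obtain ⟨x, hx, hyx⟩ : ∃ x ∈ X, ¬ G.Collinear y x := by simpa [perp] using hy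
  have hHs := hX.1.inter (isSubspace_perp {y})
  have hHX : X ∩ G.perp {y} ⊆ X := Set.inter_subset_left
  have hxH : x ∉ X ∩ G.perp {y} := fun h => hyx (mem_perp_singleton.1 h.2).symm
  have hxr := hX.1.mem_residue hHX hx hxH
  have hyr : y ∈ G.residue (X ∩ G.perp {y}) :=
    ⟨fun z hz => (mem_perp_singleton.1 hz.2).symm, fun h => hyx (hX.1.subset_perp h.1 x hx)⟩
  have hH : X ∩ G.perp {y} ∈ G.flats m := by
    have hle := hX.1.rk_le_rk_inter_perp y
    have hlt := hHs.rk_mono hX.1 hHX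
    have := rk_adjoin hHs hxr ▸ hX.2 ▸ (isSingular_adjoin hHs hxr.1).rk_mono hX.1
      (adjoin_subset hX.1.1 hHX hx)
    rw [hX.2] at hle
    exact ⟨hHs, by lia⟩
  have hHx := adjoin_eq_of_mem_flats hH hX hHX hx hxH
  obtain ⟨z, hz, hzx, hzy, hzX, hzy'⟩ := hn.exists_common_neighbor hH hm hxr hyr
    (mt Collinear.symm hyx)
  rw [hHx] at hzX
  have hzX' : z ∈ G.residue X := ⟨hHx ▸ mem_perp_adjoin.2 ⟨hzx, hz.1⟩, hzX⟩
  exact ⟨_, neighbors_adjoin hH hX hHX hzX', subset_adjoin _ z, mem_perp_adjoin.2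
    ⟨hzy.symm, hyr.1⟩, notMem_adjoin_comm hH.1 hyr.2 hz hzy'⟩

theorem HasRank.edist_le {X Y : G.grassmannian k} {e : ℕ} (hn : G.HasRank n) (hk : k + 2 ≤ n)
    (he : k + 1 ≤ G.rk (X.1 ∩ Y.1) + e) : (G.grassmannGraph n k).edist X Y ≤ (e + 1 : ℕ) := by
  have hX := mem_grassmannian_natCast.1 X.2
  have hY := mem_grassmannian_natCast.1 Y.2
  have hle {X' : G.grassmannian k} {y : P} (hy : y ∈ Y.1) (hyX' : y ∈ G.residue X'.1)
      (he' : k + 1 ≤ G.rk (X'.1 ∩ Y.1) + e) : (G.grassmannGraph n k).edist X' Y ≤ e := by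
    rw [SimpleGraph.edist_comm]
    exact edist_le_of_mem_residue hk hy hyX' (by rwa [Set.inter_comm])
  by_cases hYX : Y.1 ⊆ X.1
  · rw [Subtype.ext (eq_of_mem_flats hY hX hYX), SimpleGraph.edist_self]
    exact zero_le
  obtain ⟨y, hy, hyX⟩ := Set.not_subset.1 hYX
  by_cases hyp : y ∈ G.perp X.1
  · exact (hle hy ⟨hyp, hyX⟩ he).trans (by exact_mod_cast Nat.le_succ e)
  · obtain ⟨X', hXX', hsub, hyX'⟩ := exists_neighbor_of_not_collinear hn hk hX hyp
    refine Neighbors.edist_le_succ (X' := ⟨X', mem_grassmannian_natCast.2 hXX'.right⟩) hk hXX'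
      (hle hy hyX' (he.trans ?_))
    gcongr
    exact (hX.1.inter hY.1.1).rk_mono (hXX'.right.1.inter hY.1.1) fun w hw =>
      ⟨hsub ⟨hw.1, mem_perp_singleton.2 (hY.1.subset_perp hw.2 y hy)⟩, hw.2⟩

theorem le_rk_inter_add_length (hk : k + 2 ≤ n) {X Y : G.grassmannian k}
    (w : (G.grassmannGraph n k).Walk X Y) : k + 1 ≤ G.rk (X.1 ∩ Y.1) + w.length := by
  induction w with
  | @nil X => exact (Set.inter_self X.1).symm ▸ (mem_grassmannian_natCast.1 X.2).2.ge
  | @cons X X' Y h w ih =>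
    have h := ((adj_iff_neighbors hk X X').1 h).symm
    have hY := mem_grassmannian_natCast.1 Y.2
    have hX'Y := h.left.1.inter hY.1.1
    calc k + 1 ≤ G.rk (X'.1 ∩ Y.1) + w.length := ih
      _ ≤ G.rk (X'.1 ∩ Y.1 ∩ (X'.1 ∩ X.1)) + 1 + w.length := by
        gcongr
        exact rk_le_rk_inter_hyperplane h.inter h.left Set.inter_subset_left hX'Y
          Set.inter_subset_left
      _ ≤ G.rk (X.1 ∩ Y.1) + 1 + w.length := by
        gcongr
        exact (hX'Y.inter h.inter.1.1).rk_mono (h.right.1.inter hY.1.1) fun x hx =>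
          ⟨hx.2.2, hx.1.2⟩
      _ = G.rk (X.1 ∩ Y.1) + (w.cons _).length := by rw [SimpleGraph.Walk.length_cons]; ring

theorem OppositeOver.lt_edist {X Y : G.grassmannian k} {e : ℕ} (hk : k + 2 ≤ n)
    (h : G.OppositeOver Q (k + 1) X.1 Y.1) (hQ : Q ∈ G.flats m) (he : m + e = k + 1)
    (he0 : 0 < e) : (e : ℕ∞) < (G.grassmannGraph n k).edist X Y := by
  by_contra! hle
  obtain ⟨w, hw⟩ := SimpleGraph.exists_walk_of_edist_ne_top
    (ne_top_of_le_ne_top (ENat.natCast_ne_top e) hle)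
  rw [← hw, Nat.cast_le] at hle
  cases w with
  | nil =>
    have hr := h.left.2
    rw [← Set.inter_self X.1, h.inter_eq, hQ.2] at hr
    lia
  | @cons _ X' _ hadj w =>
    have hwX' := le_rk_inter_add_length hk w
    have hXX' := (adj_iff_neighbors hk X X').1 hadj
    have hX'Q : X'.1 ∩ Y.1 ⊆ Q := fun x hx =>
      h.inter_perp_right ⟨hx.2, hXX'.symm.subset_perp hx.1⟩
    have := hQ.2 ▸ (hXX'.right.1.inter h.right.1.1).rk_mono hQ.1 hX'Q
    rw [SimpleGraph.Walk.length_cons] at hle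
    lia

end Distance

section ResidueEmbedding

variable {P' : Type v} {G' : PointLineGeometry P'}

/-- The map `φ` sends points `x` of the residue of `N` to singular subspaces of dimension `J`, to
be thought of as images of the subspaces `⟨N, x⟩`. It sends collinear points to neighbors, unless
they represent the same point of the quotient by `N`, and non-collinear points to distinct
subspaces that are not neighbors. -/
structure IsResidueEmbedding (G : PointLineGeometry P) (G' : PointLineGeometry P') (N : Set P)
    (J : ℕ) (φ : P → Set P') : Prop where
  neighbors : ∀ x ∈ G.residue N, ∀ y ∈ G.residue N, G.Collinear x y → y ∉ G.adjoin N x →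
    G'.Neighbors J (φ x) (φ y)
  not_neighbors : ∀ x ∈ G.residue N, ∀ y ∈ G.residue N, ¬ G.Collinear x y →
    φ x ≠ φ y ∧ ¬ G'.Neighbors J (φ x) (φ y)

variable {N R : Set P} {A B : Set P'} {J m n : ℕ} {φ : P → Set P'} {a b c x y z : P}

theorem IsResidueEmbedding.mono (hφ : G.IsResidueEmbedding G' R J φ) (h : R ⊆ N) :
    G.IsResidueEmbedding G' N J φ where
  neighbors x hx y hy hxy hyx := hφ.neighbors x (residue_anti h hx) y (residue_anti h hy) hxy
    fun hyR => hyx (span_mono (Set.insert_subset_insert h) hyR)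
  not_neighbors x hx y hy := hφ.not_neighbors x (residue_anti h hx) y (residue_anti h hy)

variable [G.IsShultSpace] [G'.IsShultSpace]

theorem IsResidueEmbedding.not_subset_span (hφ : G.IsResidueEmbedding G' N J φ)
    (hN : G.IsSingular N) (hAB : G'.Neighbors J A B)
    (hA : ∀ x ∈ G.residue N, G'.Neighbors J A (φ x))
    (hB : ∀ x ∈ G.residue N, G'.Neighbors J B (φ x)) (hx : x ∈ G.residue N)
    (hI : A ∩ B ⊆ φ x) : ¬ φ x ⊆ G'.span (A ∪ B) := fun hU => by
  obtain ⟨y, hy, hyx⟩ := exists_mem_residue_not_collinear hN hx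
  obtain ⟨hne, hnot⟩ := hφ.not_neighbors x hx y hy (mt Collinear.symm hyx)
  exact hnot (hAB.of_between (hA y hy) (hB y hy) (hA x hx).right hI hU hne)

/-- Each `φ x` contains `A ∩ B` or lies in `⟨A, B⟩`, but not both. By connectedness of the residue
the same alternative holds for all `x`, and the second one would make the images of non-collinear
points neighbors. -/
theorem IsResidueEmbedding.inter_subset (hφ : G.IsResidueEmbedding G' N J φ)
    (hn : G.HasRank n) (hN : N ∈ G.flats m) (hm : m + 2 ≤ n) (hAB : G'.Neighbors J A B)
    (hA : ∀ x ∈ G.residue N, G'.Neighbors J A (φ x))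
    (hB : ∀ x ∈ G.residue N, G'.Neighbors J B (φ x)) (hx : x ∈ G.residue N) :
    A ∩ B ⊆ φ x := by
  have hor (z) (hz : z ∈ G.residue N) : A ∩ B ⊆ φ z ∨ φ z ⊆ G'.span (A ∪ B) :=
    hAB.inter_subset_or_subset_span (hA z hz) (hB z hz)
  refine (hor x hx).resolve_right fun hxU => ?_
  obtain ⟨y, hy, hyx⟩ := exists_mem_residue_not_collinear hN.1 hx
  have hyU : φ y ⊆ G'.span (A ∪ B) := by
    refine hn.residue_induction hN hm (T := fun z => φ z ⊆ G'.span (A ∪ B))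
      (fun c hc d hd hcd hdc hcU => ?_) hx hy hxU
    by_contra hdU
    have hId := (hor d hd).resolve_right hdU
    exact hφ.not_subset_span hN.1 hAB hA hB hc
      (hAB.inter_subset_of_subset_span (hφ.neighbors c hc d hd hcd hdc) hcU hId hdU) hcU
  obtain ⟨hne, hnot⟩ := hφ.not_neighbors x hx y hy (mt Collinear.symm hyx)
  exact hnot (neighbors_of_subset (hA x hx).right (hA y hy).right hAB.span_union_mem_flats hne
    hxU hyU)

theorem IsResidueEmbedding.inter_subset_of_mem_residue (hφ : G.IsResidueEmbedding G' R J φ)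
    (hn : G.HasRank n) (hR : R ∈ G.flats m) (hm : m + 4 ≤ n) (ha : a ∈ G.residue R)
    (hb : b ∈ G.residue (G.adjoin R a)) (hc : c ∈ G.residue (G.adjoin (G.adjoin R a) b)) :
    φ a ∩ φ b ⊆ φ c := by
  have hRa := adjoin_mem_flats hR ha
  have hN := adjoin_mem_flats hRa hb
  have hRN := (subset_adjoin R a).trans (subset_adjoin (G := G) (G.adjoin R a) b)
  have haN : a ∈ G.adjoin (G.adjoin R a) b := subset_adjoin _ b (mem_adjoin R a)
  have hbN : b ∈ G.adjoin (G.adjoin R a) b := mem_adjoin _ b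
  have hbR := residue_anti (subset_adjoin R a) hb
  have hab := hφ.neighbors a ha b hbR (hb.1 a (mem_adjoin R a)).symm hb.2
  have hmem {y} (hy : y ∈ G.residue R) (hyN : y ∈ G.adjoin (G.adjoin R a) b) (x)
      (hx : x ∈ G.residue (G.adjoin (G.adjoin R a) b)) : G'.Neighbors J (φ y) (φ x) :=
    hφ.neighbors y hy x (residue_anti hRN hx) (hx.1 y hyN).symm
      fun h => hx.2 (adjoin_subset hN.1.1 hRN hyN h)
  exact (hφ.mono hRN).inter_subset hn hN (by lia) hab (hmem ha haN) (hmem hbR hbN) hc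

theorem IsResidueEmbedding.inter_subset_of_mem_residue_adjoin
    (hφ : G.IsResidueEmbedding G' R J φ) (hn : G.HasRank n) (hR : R ∈ G.flats m)
    (hm : m + 4 ≤ n) (hx : x ∈ G.residue R) (hy : y ∈ G.residue (G.adjoin R x))
    (hz : z ∈ G.residue (G.adjoin R x)) : φ x ∩ φ y ⊆ φ z :=
  hn.residue_induction (adjoin_mem_flats hR hx) (by lia) (T := fun z => φ x ∩ φ y ⊆ φ z)
    (fun _ hc _ hd hcd hdc hxy => (Set.subset_inter Set.inter_subset_left hxy).trans
      (hφ.inter_subset_of_mem_residue hn hR hm hx hc (mem_residue_adjoin hd hcd.symm hdc)))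
    hy hz Set.inter_subset_right

theorem IsResidueEmbedding.exists_mem_flats_subset (hφ : G.IsResidueEmbedding G' R J φ)
    (hn : G.HasRank n) (hR : R ∈ G.flats m) (hm : m + 4 ≤ n) :
    ∃ I ∈ G'.flats J, ∀ x ∈ G.residue R, I ⊆ φ x := by
  obtain ⟨a, ha⟩ := hn.exists_mem_residue hR.1 (by rw [hR.2]; lia)
  have hRa := adjoin_mem_flats hR ha
  obtain ⟨b, hb⟩ := hn.exists_mem_residue hRa.1 (by rw [hRa.2]; lia)
  have hab := hφ.neighbors a ha b (residue_anti (subset_adjoin R a) hb)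
    (hb.1 a (mem_adjoin R a)).symm hb.2
  refine ⟨φ a ∩ φ b, hab.inter, fun x hx => ?_⟩
  refine (hn.residue_induction hR (by lia)
    (T := fun x => φ a ∩ φ b ⊆ φ x ∧ ∀ y ∈ G.residue (G.adjoin R x), φ a ∩ φ b ⊆ φ y)
    (fun c hc d hd hcd hdc hIc => ?_) ha hx ⟨Set.inter_subset_left, fun y hy =>
      hφ.inter_subset_of_mem_residue_adjoin hn hR hm ha hb hy⟩).1
  have hId := hIc.2 d (mem_residue_adjoin hd hcd.symm hdc)
  have hcR := mem_residue_adjoin hc hcd (notMem_adjoin_comm hR.1 hc.2 hd hdc)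
  exact ⟨hId, fun y hy => (Set.subset_inter hId hIc.1).trans
    (hφ.inter_subset_of_mem_residue_adjoin hn hR hm hd hcR hy)⟩

end ResidueEmbedding

section LocalEmbedding

variable {P' : Type v} {G' : PointLineGeometry P'}

/-- The map `F` sends singular subspaces of dimension `j` to singular subspaces of dimension `J`.
It preserves being neighbors, and it sends subspaces that share a hyperplane without being
perpendicular to distinct subspaces that are not neighbors. -/
structure IsLocalEmbedding (G : PointLineGeometry P) (G' : PointLineGeometry P') (j J : ℕ)
    (F : Set P → Set P') : Prop where
  mapsTo : Set.MapsTo F (G.flats (j + 1)) (G'.flats (J + 1))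
  neighbors : ∀ X Y, G.Neighbors j X Y → G'.Neighbors J (F X) (F Y)
  not_neighbors : ∀ H ∈ G.flats j, ∀ X ∈ G.flats (j + 1), ∀ Y ∈ G.flats (j + 1), H ⊆ X → H ⊆ Y →
    ¬ X ⊆ G.perp Y → F X ≠ F Y ∧ ¬ G'.Neighbors J (F X) (F Y)

/-- The common part of the images under `F` of all `j`-dimensional singular subspaces
containing `R`. It serves as the image of `R` when `R` has dimension `j - 1`. -/
def starMap (G : PointLineGeometry P) (j : ℕ) (F : Set P → Set P') (R : Set P) : Set P' :=
  {y | ∀ X ∈ G.flats (j + 1), R ⊆ X → y ∈ F X}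

variable {R S T H X Y : Set P} {A B C U V : Set P'} {j J m n : ℕ} {F : Set P → Set P'}

theorem starMap_subset (hX : X ∈ G.flats (j + 1)) (h : R ⊆ X) : G.starMap j F R ⊆ F X :=
  fun _ hy => hy X hX h

theorem neighbors_of_subset_perp [G'.IsShultSpace] (hA : A ∈ G'.flats (m + 1))
    (hB : B ∈ G'.flats (m + 1)) (hC : C ∈ G'.flats (m + 1)) (hU : U ∈ G'.flats (m + 2))
    (hV : V ∈ G'.flats (m + 2)) (hAU : A ⊆ U) (hCU : C ⊆ U) (hAC : A ≠ C) (hBV : B ⊆ V)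
    (hCV : C ⊆ V) (hBC : B ≠ C) (hAB : A ⊆ G'.perp B) (hUV : U ≠ V) :
    G'.Neighbors (m + 1) U V := by
  refine neighbors_of_hyperplane hC hU hV hUV hCU hCV ?_
  have hCC := hC.1.subset_perp
  have hUC : U ⊆ G'.perp C := hU.1.subset_perp.trans (perp_anti hCU)
  have hVC : C ⊆ G'.perp V := hCV.trans hV.1.subset_perp
  rw [eq_span_union hA hC hU hAC hAU hCU, eq_span_union hB hC hV hBC hBV hCV]
  refine span_subset_perp_span ?_
  rintro x (hx | hx) y (hy | hy)
  exacts [hAB hx y hy, hUC (hAU hx) y hy, hVC hx y (hBV hy), hCC hx y hy]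

variable [G.IsShultSpace]

theorem adjoin_subset_perp_adjoin {s t : P} (hH : G.IsSingular H) (hs : s ∈ G.residue H)
    (ht : t ∈ G.residue H) (hst : G.Collinear s t) :
    G.adjoin H s ⊆ G.perp (G.adjoin H t) := by
  refine span_subset_perp_span ?_
  rintro x (rfl | hx) y (rfl | hy)
  exacts [hst, hs.1 y hy, (ht.1 x hx).symm, hH.subset_perp hx y hy]

theorem HasRank.exists_neighbors_of_not_subset_perp (hn : G.HasRank n) (hm : m + 2 ≤ n)
    (hH : H ∈ G.flats m) (hS : S ∈ G.flats (m + 1)) (hT : T ∈ G.flats (m + 1)) (hHS : H ⊆ S)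
    (hHT : H ⊆ T) (hST : ¬ S ⊆ G.perp T) : ∃ E, G.Neighbors m S E ∧ G.Neighbors m T E := by
  obtain ⟨s, hs, rfl⟩ := exists_adjoin_eq hH hS hHS
  obtain ⟨t, ht, rfl⟩ := exists_adjoin_eq hH hT hHT
  obtain ⟨e, he, hes, het, heS, heT⟩ := hn.exists_common_neighbor hH hm hs ht
    (mt (adjoin_subset_perp_adjoin hH.1 hs ht) hST)
  exact ⟨G.adjoin H e, neighbors_adjoin hH hS hHS (mem_residue_adjoin he hes heS),
    neighbors_adjoin hH hT hHT (mem_residue_adjoin he het heT)⟩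

theorem IsLocalEmbedding.isResidueEmbedding (hF : G.IsLocalEmbedding G' j J F)
    (hR : R ∈ G.flats j) : G.IsResidueEmbedding G' R J fun x => F (G.adjoin R x) where
  neighbors _ hx _ hy hxy hyx := hF.neighbors _ _ (neighbors_adjoin hR (adjoin_mem_flats hR hx)
    (subset_adjoin R _) (mem_residue_adjoin hy hxy.symm hyx))
  not_neighbors x hx y hy hxy := hF.not_neighbors R hR _ (adjoin_mem_flats hR hx) _
    (adjoin_mem_flats hR hy) (subset_adjoin R x) (subset_adjoin R y)
    fun h => hxy (h (mem_adjoin R x) y (mem_adjoin R y))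

variable [G'.IsShultSpace]

theorem IsLocalEmbedding.starMap_mem_flats (hF : G.IsLocalEmbedding G' j J F)
    (hn : G.HasRank n) (hj : j + 4 ≤ n) (hR : R ∈ G.flats j) : G.starMap j F R ∈ G'.flats J := by
  have hφ := hF.isResidueEmbedding hR
  obtain ⟨I, hI, hIF⟩ := hφ.exists_mem_flats_subset hn hR hj
  obtain ⟨a, ha⟩ := hn.exists_mem_residue hR.1 (by rw [hR.2]; lia)
  have hRa := adjoin_mem_flats hR ha
  obtain ⟨b, hb⟩ := hn.exists_mem_residue hRa.1 (by rw [hRa.2]; lia)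
  have hbR := residue_anti (subset_adjoin R a) hb
  have hab := hφ.neighbors a ha b hbR (hb.1 a (mem_adjoin R a)).symm hb.2
  have hI' : I = F (G.adjoin R a) ∩ F (G.adjoin R b) :=
    eq_of_mem_flats hI hab.inter (Set.subset_inter (hIF a ha) (hIF b hbR))
  have hstar : G.starMap j F R = I := by
    refine Set.Subset.antisymm (hI' ▸ Set.subset_inter (starMap_subset hRa (subset_adjoin R a))
      (starMap_subset (adjoin_mem_flats hR hbR) (subset_adjoin R b))) fun y hy X hX hRX => ?_
    obtain ⟨x, hx, rfl⟩ := exists_adjoin_eq hR hX hRX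
    exact hIF x hx hy
  exact hstar ▸ hI

theorem IsLocalEmbedding.neighbors_starMap (hF : G.IsLocalEmbedding G' (j + 1) (J + 1) F)
    (hn : G.HasRank n) (hj : j + 5 ≤ n) (h : G.Neighbors j S T)
    (hne : G.starMap (j + 1) F S ≠ G.starMap (j + 1) F T) :
    G'.Neighbors J (G.starMap (j + 1) F S) (G.starMap (j + 1) F T) := by
  have hU := h.span_union_mem_flats
  exact neighbors_of_subset (hF.starMap_mem_flats hn hj h.left)
    (hF.starMap_mem_flats hn hj h.right) (hF.mapsTo hU) hne
    (starMap_subset hU (Set.subset_union_left.trans (subset_span _)))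
    (starMap_subset hU (Set.subset_union_right.trans (subset_span _)))

theorem IsLocalEmbedding.starMap_isLocalEmbedding
    (hF : G.IsLocalEmbedding G' (j + 1) (J + 1) F) (hn : G.HasRank n) (hj : j + 5 ≤ n)
    (hne : ∀ H ∈ G.flats j, ∀ S ∈ G.flats (j + 1), ∀ T ∈ G.flats (j + 1), H ⊆ S → H ⊆ T →
      S ≠ T → G.starMap (j + 1) F S ≠ G.starMap (j + 1) F T) :
    G.IsLocalEmbedding G' j J (G.starMap (j + 1) F) := by
  have hstar {R} : R ∈ G.flats (j + 1) → G.starMap (j + 1) F R ∈ G'.flats (J + 1) :=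
    hF.starMap_mem_flats hn hj
  have hnbr (S T) (h : G.Neighbors j S T) :
      G'.Neighbors J (G.starMap (j + 1) F S) (G.starMap (j + 1) F T) :=
    hF.neighbors_starMap hn hj h (hne _ h.inter S h.left T h.right Set.inter_subset_left
      Set.inter_subset_right h.ne)
  refine ⟨fun R => hstar, hnbr, fun H hH S hS T hT hHS hHT hST => ⟨hne H hH S hS T hT hHS hHT ?_,
    fun hnST => ?_⟩⟩
  · rintro rfl
    exact hST hS.1.subset_perp
  obtain ⟨E, hSE, hTE⟩ := hn.exists_neighbors_of_not_subset_perp (by lia) hH hS hT hHS hHT hST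
  have hX := hSE.span_union_mem_flats
  have hY := hTE.span_union_mem_flats
  have hSX := Set.subset_union_left.trans (subset_span (G := G) (S ∪ E))
  have hEX := Set.subset_union_right.trans (subset_span (G := G) (S ∪ E))
  have hTY := Set.subset_union_left.trans (subset_span (G := G) (T ∪ E))
  have hEY := Set.subset_union_right.trans (subset_span (G := G) (T ∪ E))
  obtain ⟨hXY, hnXY⟩ := hF.not_neighbors E hSE.right _ hX _ hY hEX hEY
    fun h => hST (hSX.trans (h.trans (perp_anti hTY)))
  exact hnXY (neighbors_of_subset_perp hnST.left hnST.right (hstar hSE.right) (hF.mapsTo hX)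
    (hF.mapsTo hY) (starMap_subset hX hSX) (starMap_subset hX hEX) (hnbr S E hSE).ne
    (starMap_subset hY hTY) (starMap_subset hY hEY) (hnbr T E hTE).ne hnST.subset_perp hXY)

end LocalEmbedding

section DualPolar

variable {A B C D : Set P} {k m n : ℕ}

variable [G.IsShultSpace]

theorem HasRank.exists_mem_flats (hn : G.HasRank n) (hm : m ≤ n) : ∃ X, X ∈ G.flats m := by
  induction m with
  | zero => exact ⟨∅, empty_mem_flats⟩
  | succ m ih =>
    obtain ⟨X, hX⟩ := ih (by lia)
    obtain ⟨p, hp⟩ := hn.exists_mem_residue hX.1 (by rw [hX.2]; lia)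
    exact ⟨_, adjoin_mem_flats hX hp⟩

/-- A point of `A ∩ B` outside `C` would be collinear to all points of the maximal singular
subspace `C`, because `C` is spanned by `B ∩ C` and a point of `A ∩ C`. -/
theorem HasRank.inter_subset_of_inter_mem_flats (hn : G.HasRank (m + 1)) (hA : G.IsSingular A)
    (hB : G.IsSingular B) (hC : C ∈ G.flats (m + 1)) (hAB : A ∩ B ∈ G.flats m)
    (hAC : A ∩ C ∈ G.flats m) (hBC : B ∩ C ∈ G.flats m) : A ∩ B ⊆ C := by
  by_cases h : A ∩ C ⊆ B
  · rw [← eq_of_mem_flats hAC hAB (Set.subset_inter Set.inter_subset_left h)]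
    exact Set.inter_subset_right
  obtain ⟨x, hx, hxB⟩ := Set.not_subset.1 h
  have hCx := adjoin_eq_of_mem_flats hBC hC Set.inter_subset_right hx.2 fun h => hxB h.1
  intro y hy
  by_contra hyC
  have hyres : y ∈ G.residue C := ⟨hCx ▸ mem_perp_adjoin.2
    ⟨hA.subset_perp hy.1 x hx.1, fun z hz => hB.subset_perp hy.2 z hz.1⟩, hyC⟩
  have hCy := adjoin_mem_flats hC hyres
  exact absurd (hCy.2.ge.trans (hn.rk_le hCy.1)) (Nat.not_succ_le_self _)

theorem adj_iff_inter_mem_flats {X Y : G.grassmannian k} :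
    (G.grassmannGraph (k + 1) k).Adj X Y ↔ X ≠ Y ∧ X.1 ∩ Y.1 ∈ G.flats k := by
  have hI := X.2.1.inter Y.2.1.1
  refine and_congr_right fun _ => ⟨?_, fun h => Or.inr ⟨by push_cast; ring, ?_⟩⟩
  · rintro (⟨h, -⟩ | ⟨-, h⟩)
    · lia
    · exact ⟨hI, by have := hI.hasDim_iff.1 h; lia⟩
  · exact hI.hasDim_iff.2 (by rw [h.2]; ring)

theorem HasRank.adj_of_adj_of_adj {A B C D : G.grassmannian k} (hn : G.HasRank (k + 1))
    (hAB : (G.grassmannGraph (k + 1) k).Adj A B) (hAC : (G.grassmannGraph (k + 1) k).Adj A C)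
    (hBC : (G.grassmannGraph (k + 1) k).Adj B C) (hAD : (G.grassmannGraph (k + 1) k).Adj A D)
    (hBD : (G.grassmannGraph (k + 1) k).Adj B D) (hCD : C ≠ D) :
    (G.grassmannGraph (k + 1) k).Adj C D := by
  rw [adj_iff_inter_mem_flats] at *
  have hsub {E : G.grassmannian k} (hAE : A.1 ∩ E.1 ∈ G.flats k) (hBE : B.1 ∩ E.1 ∈ G.flats k) :
      A.1 ∩ B.1 ⊆ E.1 :=
    hn.inter_subset_of_inter_mem_flats A.2.1 B.2.1 (mem_grassmannian_natCast.1 E.2) hAB.2 hAE hBE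
  refine ⟨hCD, ?_⟩
  rw [inter_eq_of_mem_flats hAB.2 (mem_grassmannian_natCast.1 C.2)
    (mem_grassmannian_natCast.1 D.2) (Subtype.coe_ne_coe.2 hCD) (hsub hAC.2 hBC.2)
    (hsub hAD.2 hBD.2)]
  exact hAB.2

theorem HasRank.exists_diamond (hn : G.HasRank n) (hm : m + 3 ≤ n) :
    ∃ A B C D, G.Neighbors m A B ∧ G.Neighbors m A C ∧ G.Neighbors m B C ∧ G.Neighbors m A D ∧
      G.Neighbors m B D ∧ ¬ C ⊆ G.perp D := by
  obtain ⟨R, hR⟩ := hn.exists_mem_flats (m := m) (by lia)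
  obtain ⟨a, ha⟩ := hn.exists_mem_residue hR.1 (by rw [hR.2]; lia)
  have hA := adjoin_mem_flats hR ha
  obtain ⟨b, hb⟩ := hn.exists_mem_residue hA.1 (by rw [hA.2]; lia)
  have hAB := neighbors_adjoin hR hA (subset_adjoin R a) hb
  have hU := hAB.span_union_mem_flats
  have hAU := Set.subset_union_left.trans (subset_span (G := G) (G.adjoin R a ∪ G.adjoin R b))
  have hBU := Set.subset_union_right.trans (subset_span (G := G) (G.adjoin R a ∪ G.adjoin R b))
  obtain ⟨c, hc⟩ := hn.exists_mem_residue hU.1 (by rw [hU.2]; lia)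
  obtain ⟨d, hd, hdc⟩ := exists_mem_residue_not_collinear hU.1 hc
  have hleft {x} (hx : x ∈ G.residue (G.span (G.adjoin R a ∪ G.adjoin R b))) :=
    neighbors_adjoin hR hA (subset_adjoin R a) (residue_anti hAU hx)
  have hright {x} (hx : x ∈ G.residue (G.span (G.adjoin R a ∪ G.adjoin R b))) :=
    neighbors_adjoin hR hAB.right (subset_adjoin R b) (residue_anti hBU hx)
  exact ⟨_, _, _, _, hAB, hleft hc, hright hc, hleft hd, hright hd, fun h =>
    hdc (h (mem_adjoin R c) d (mem_adjoin R d)).symm⟩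

/-- In a dual polar graph, two triangles on a common edge span a clique. This fails in the other
Grassmann graphs, so these do not embed in dual polar graphs. -/
theorem HasRank.add_two_le_of_embedding {P' : Type v} {G' : PointLineGeometry P'}
    [G'.IsShultSpace] {n' k' : ℕ} (hn : G.HasRank n) (hn' : G'.HasRank n') (hkn : k + 3 ≤ n)
    (f : G.grassmannGraph n k ↪g G'.grassmannGraph n' k') : k' + 2 ≤ n' := by
  obtain ⟨A, B, C, D, hAB, hAC, hBC, hAD, hBD, hCD⟩ := hn.exists_diamond hkn
  lift A to G.grassmannian k using mem_grassmannian_natCast.2 hAB.left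
  lift B to G.grassmannian k using mem_grassmannian_natCast.2 hAB.right
  lift C to G.grassmannian k using mem_grassmannian_natCast.2 hAC.right
  lift D to G.grassmannian k using mem_grassmannian_natCast.2 hAD.right
  have hadj (X Y : G.grassmannian k) :
      (G'.grassmannGraph n' k').Adj (f X) (f Y) ↔ G.Neighbors k X.1 Y.1 :=
    f.map_adj_iff.trans (adj_iff_neighbors (by lia) X Y)
  by_contra! hlt
  have hfA := mem_grassmannian_natCast.1 (f A).2
  obtain rfl : n' = k' + 1 := by have := hfA.2.ge.trans (hn'.rk_le hfA.1); lia
  refine hCD ((hadj C D).1 ?_).subset_perp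
  refine hn'.adj_of_adj_of_adj ((hadj _ _).2 hAB) ((hadj _ _).2 hAC) ((hadj _ _).2 hBC)
    ((hadj _ _).2 hAD) ((hadj _ _).2 hBD) (f.injective.ne ?_)
  rintro rfl
  exact hCD C.2.1.subset_perp

end DualPolar

section Descent

variable {P' : Type v} {G' : PointLineGeometry P'}

/-- The result of descending from the `k`-dimensional singular subspaces to dimension `i`: the
local embedding `F` sends `i`-dimensional singular subspaces to `J`-dimensional ones, and `f X` is
spanned by the images of the `i`-dimensional subspaces of `X`. -/
structure IsDescent (G : PointLineGeometry P) (G' : PointLineGeometry P') {k k' : ℕ}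
    (f : G.grassmannian k → G'.grassmannian k') (i J : ℕ) (F : Set P → Set P') : Prop where
  isLocalEmbedding : G.IsLocalEmbedding G' i J F
  add_eq : J + k = k' + i
  subset_iff : ∀ (X : G.grassmannian k) (T : Set P'), G'.IsSubspace T →
    ((f X).1 ⊆ T ↔ ∀ R ∈ G.flats (i + 1), R ⊆ X.1 → F R ⊆ T)

variable {R H S T : Set P} {i J k k' m n n' : ℕ} {F : Set P → Set P'}

theorem IsDescent.subset {f : G.grassmannian k → G'.grassmannian k'} {X : G.grassmannian k}
    (h : G.IsDescent G' f i J F) (hR : R ∈ G.flats (i + 1)) (hRX : R ⊆ X.1) : F R ⊆ (f X).1 :=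
  (h.subset_iff X _ (f X).2.1.1).1 subset_rfl R hR hRX

variable [G.IsShultSpace]

theorem exists_neighbors_subset (hR : R ∈ G.flats (m + 2)) :
    ∃ A B, G.Neighbors m A B ∧ A ⊆ R ∧ B ⊆ R := by
  obtain ⟨A, hA, -, hAR⟩ := exists_hyperplane isSingular_empty hR (Set.empty_subset R)
    (by rw [rk_empty]; lia)
  obtain ⟨p, hp, hpA⟩ := hR.1.exists_mem_notMem hA.1 (by rw [hA.2, hR.2]; lia)
  have hp0 := adjoin_mem_flats (p := p) empty_mem_flats
    (hR.1.mem_residue (Set.empty_subset R) hp (Set.notMem_empty p))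
  obtain ⟨B, hB, hpB, hBR⟩ := exists_hyperplane hp0.1 hR
    (adjoin_subset hR.1.1 (Set.empty_subset R) hp) (by rw [hp0.2]; lia)
  refine ⟨A, B, neighbors_of_subset hA hB hR ?_ hAR hBR, hAR, hBR⟩
  rintro rfl
  exact hpA (hpB (mem_adjoin ∅ p))

theorem IsDescent.starMap_subset {f : G.grassmannian k → G'.grassmannian k'}
    {X : G.grassmannian k} (h : G.IsDescent G' f (i + 1) J F) (hik : i + 1 ≤ k)
    (hR : R ∈ G.flats (i + 1)) (hRX : R ⊆ X.1) : G.starMap (i + 1) F R ⊆ (f X).1 := by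
  have hX := mem_grassmannian_natCast.1 X.2
  obtain ⟨p, hp, hpR⟩ := hX.1.exists_mem_notMem hR.1 (by rw [hR.2, hX.2]; lia)
  have hA := adjoin_mem_flats hR (hX.1.mem_residue hRX hp hpR)
  exact (PointLineGeometry.starMap_subset hA (subset_adjoin R p)).trans
    (h.subset hA (adjoin_subset hX.1.1 hRX hp))

variable [G'.IsShultSpace] {f : G.grassmannGraph n k ↪g G'.grassmannGraph n' k'}

theorem isDescent_extend (hkn : k + 2 ≤ n) (hkn' : k' + 2 ≤ n') :
    G.IsDescent G' f k k' (Function.extend Subtype.val (fun X => (f X).1) fun _ => ∅) := by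
  have happ (X : G.grassmannian k) :
      Function.extend Subtype.val (fun X => (f X).1) (fun _ => ∅) X.1 = (f X).1 :=
    Subtype.val_injective.extend_apply _ _ X
  have hadj (X Y : G.grassmannian k) : G'.Neighbors k' (f X).1 (f Y).1 ↔ G.Neighbors k X.1 Y.1 :=
    ((adj_iff_neighbors hkn' _ _).symm.trans f.map_adj_iff).trans (adj_iff_neighbors hkn X Y)
  refine ⟨⟨fun X hX => ?_, fun X Y h => ?_, fun H _ X hX Y hY _ _ hXY => ?_⟩, rfl,
    fun X T _ => ⟨fun hT R hR hRX => ?_, fun h => ?_⟩⟩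
  · lift X to G.grassmannian k using mem_grassmannian_natCast.2 hX
    rw [happ]
    exact mem_grassmannian_natCast.1 (f X).2
  · lift X to G.grassmannian k using mem_grassmannian_natCast.2 h.left
    lift Y to G.grassmannian k using mem_grassmannian_natCast.2 h.right
    rw [happ, happ]
    exact (hadj X Y).2 h
  · lift X to G.grassmannian k using mem_grassmannian_natCast.2 hX
    lift Y to G.grassmannian k using mem_grassmannian_natCast.2 hY
    rw [happ, happ, hadj]
    refine ⟨fun h => hXY ?_, fun h => hXY h.subset_perp⟩
    rw [f.injective (Subtype.ext h)]
    exact Y.2.1.subset_perp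
  · rwa [eq_of_mem_flats hR (mem_grassmannian_natCast.1 X.2) hRX, happ]
  · rw [← happ]
    exact h X.1 (mem_grassmannian_natCast.1 X.2) subset_rfl

/-- Choose `X ⊇ S` and `Y ⊇ T` opposite over `H`, hence as far apart as two subspaces sharing
`H` can be. If the two stars had the same image, then `f X` and `f Y` would meet in too large a
subspace for their distance. -/
theorem IsDescent.starMap_ne (h : G.IsDescent G' f (i + 1) J F) (hn : G.HasRank n)
    (hn' : G'.HasRank n') (hkn : k + 4 ≤ n) (hkn' : k' + 2 ≤ n') (hik : i + 1 ≤ k)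
    (hf : ∀ X Y, (G'.grassmannGraph n' k').edist (f X) (f Y) = (G.grassmannGraph n k).edist X Y)
    (hH : H ∈ G.flats i) (hS : S ∈ G.flats (i + 1)) (hT : T ∈ G.flats (i + 1)) (hHS : H ⊆ S)
    (hHT : H ⊆ T) (hne : S ≠ T) : G.starMap (i + 1) F S ≠ G.starMap (i + 1) F T := by
  obtain ⟨s, hs, rfl⟩ := exists_adjoin_eq hH hS hHS
  obtain ⟨t, ht, rfl⟩ := exists_adjoin_eq hH hT hHT
  have hts : t ∉ G.adjoin H s := fun hts => hne (adjoin_eq_of_mem hH.1 hs hts ht.2).symm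
  obtain ⟨X, Y, hXY, hSX, hTY⟩ := hn.exists_oppositeOver (K := k + 1) hH hs ht hts
    (by lia) (by lia)
  lift X to G.grassmannian k using mem_grassmannian_natCast.2 hXY.left
  lift Y to G.grassmannian k using mem_grassmannian_natCast.2 hXY.right
  intro heq
  have hstar := h.isLocalEmbedding.starMap_mem_flats hn (by lia) hS
  have hle := hstar.1.rk_mono ((f X).2.1.inter (f Y).2.1.1) (Set.subset_inter
    (h.starMap_subset hik hS hSX) (heq ▸ h.starMap_subset hik hT hTY))
  have hlt := hXY.lt_edist (n := n) (e := k + 1 - i) (by lia) hH (by lia) (by lia)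
  have hge := hn'.edist_le (X := f X) (Y := f Y) (e := k - i) hkn'
    (by have := h.add_eq; rw [hstar.2] at hle; lia)
  rw [hf] at hge
  exact hlt.not_ge (hge.trans_eq (by rw [Nat.sub_add_comm (by lia)]))

theorem IsDescent.pos (h : G.IsDescent G' f (i + 1) J F) (hn : G.HasRank n)
    (hn' : G'.HasRank n') (hkn : k + 4 ≤ n) (hkn' : k' + 2 ≤ n') (hik : i + 1 ≤ k)
    (hf : ∀ X Y, (G'.grassmannGraph n' k').edist (f X) (f Y) =
      (G.grassmannGraph n k).edist X Y) : 0 < J := by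
  obtain ⟨R, hR⟩ := hn.exists_mem_flats (m := i + 2) (by lia)
  obtain ⟨A, B, hAB, -, -⟩ := exists_neighbors_subset hR
  refine Nat.pos_of_ne_zero fun hJ => h.starMap_ne hn hn' hkn hkn' hik hf hAB.inter hAB.left
    hAB.right Set.inter_subset_left Set.inter_subset_right hAB.ne ?_
  have hempty {S} (hS : S ∈ G.flats (i + 1)) : ∅ = G.starMap (i + 1) F S :=
    eq_of_mem_flats empty_mem_flats
      (hJ ▸ h.isLocalEmbedding.starMap_mem_flats hn (by lia) hS) (Set.empty_subset _)
  rw [← hempty hAB.left, ← hempty hAB.right]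

theorem IsDescent.succ (h : G.IsDescent G' f (i + 1) (J + 1) F) (hn : G.HasRank n)
    (hn' : G'.HasRank n') (hkn : k + 4 ≤ n) (hkn' : k' + 2 ≤ n') (hik : i + 1 ≤ k)
    (hf : ∀ X Y, (G'.grassmannGraph n' k').edist (f X) (f Y) =
      (G.grassmannGraph n k).edist X Y) :
    G.IsDescent G' f i J (G.starMap (i + 1) F) := by
  have hloc := h.isLocalEmbedding.starMap_isLocalEmbedding hn (by lia)
    fun H hH S hS T hT => h.starMap_ne hn hn' hkn hkn' hik hf hH hS hT
  refine ⟨hloc, by have := h.add_eq; lia, fun X T hT => ⟨fun hXT R hR hRX =>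
    (h.starMap_subset hik hR hRX).trans hXT, fun hall => ?_⟩⟩
  refine (h.subset_iff X T hT).2 fun R hR hRX => ?_
  obtain ⟨A, B, hAB, hAR, hBR⟩ := exists_neighbors_subset hR
  have hFAB := hloc.neighbors A B hAB
  rw [eq_span_union hFAB.left hFAB.right (h.isLocalEmbedding.mapsTo hR) hFAB.ne
    (PointLineGeometry.starMap_subset hR hAR) (PointLineGeometry.starMap_subset hR hBR)]
  exact span_subset hT (Set.union_subset (hall A hAB.left (hAR.trans hRX))
    (hall B hAB.right (hBR.trans hRX)))

theorem exists_isDescent (hn : G.HasRank n) (hn' : G'.HasRank n') (hkn : k + 4 ≤ n)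
    (f : G.grassmannGraph n k ↪g G'.grassmannGraph n' k')
    (hf : ∀ X Y, (G'.grassmannGraph n' k').edist (f X) (f Y) =
      (G.grassmannGraph n k).edist X Y) : ∃ J F, G.IsDescent G' f 0 J F := by
  have hkn' := hn.add_two_le_of_embedding hn' (by lia) f
  refine Nat.decreasingInduction (motive := fun i _ => ∃ J F, G.IsDescent G' f i J F)
    (fun i hi ⟨J, F, h⟩ => ?_) ⟨k', _, isDescent_extend (by lia) hkn'⟩ (Nat.zero_le k)
  obtain ⟨J, rfl⟩ := Nat.exists_eq_add_of_lt (h.pos hn hn' hkn hkn' hi hf)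
  exact ⟨_, _, (Nat.zero_add J ▸ h).succ hn hn' hkn hkn' hi hf⟩

end Descent

section Points

variable {R : Set P} {p q : P}

theorem adjoin_empty (p : P) : G.adjoin ∅ p = {p} := by
  have hp : G.IsSubspace {p} := fun _ hx _ hy hxy => absurd (hx.trans hy.symm) hxy
  rw [adjoin, insert_empty_eq, hp.span_eq]

variable [G.IsShultSpace]

theorem singleton_mem_flats (p : P) : {p} ∈ G.flats 1 := by
  have hp := adjoin_mem_flats (G := G) (p := p) empty_mem_flats
    ⟨fun _ h => h.elim, Set.notMem_empty p⟩
  rwa [adjoin_empty] at hp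

theorem exists_eq_singleton (hR : R ∈ G.flats 1) : ∃ p, R = {p} := by
  obtain ⟨p, -, rfl⟩ := exists_adjoin_eq empty_mem_flats hR (Set.empty_subset R)
  exact ⟨p, adjoin_empty p⟩

theorem neighbors_singleton (hpq : G.Collinear p q) (hne : p ≠ q) : G.Neighbors 0 {p} {q} :=
  neighbors_of_hyperplane empty_mem_flats (singleton_mem_flats p) (singleton_mem_flats q)
    (Set.singleton_injective.ne hne) (Set.empty_subset _) (Set.empty_subset _)
    (Set.singleton_subset_iff.2 (mem_perp_singleton.2 hpq))

end Points

section Quotient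

variable {S X : Set P} {m : ℕ}

variable [G.IsShultSpace]

theorem mem_quotientPoints (hS : S ∈ G.flats m) :
    X ∈ G.quotientPoints S ↔ S ⊆ X ∧ X ∈ G.flats (m + 1) := by
  refine and_congr_right fun _ => ⟨fun ⟨d, hd, hX⟩ => ?_, fun hX => ⟨(m : ℤ) - 1, ?_, ?_⟩⟩
  · obtain ⟨hX, hr⟩ := mem_grassmannian_iff.1 hX
    exact ⟨hX, by have := hS.1.hasDim_iff.1 hd; rw [hS.2] at this; lia⟩
  · exact hS.1.hasDim_iff.2 (by rw [hS.2]; ring)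
  · exact mem_grassmannian_iff.2 ⟨hX.1, by rw [hX.2]; push_cast; ring⟩

theorem mem_quotient_lines (hS : S ∈ G.flats m) {L : Set (G.quotientPoints S)} :
    L ∈ (G.quotient S).lines ↔ ∃ U ∈ G.flats (m + 2), S ⊆ U ∧ L = {Y | Y.1 ⊆ U} := by
  constructor
  · rintro ⟨d, hd, U, hU, hSU, rfl⟩
    obtain ⟨hU, hr⟩ := mem_grassmannian_iff.1 hU
    exact ⟨U, ⟨hU, by have := hS.1.hasDim_iff.1 hd; rw [hS.2] at this; lia⟩, hSU, rfl⟩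
  · rintro ⟨U, hU, hSU, rfl⟩
    exact ⟨(m : ℤ) - 1, hS.1.hasDim_iff.2 (by rw [hS.2]; ring), U,
      mem_grassmannian_iff.2 ⟨hU.1, by rw [hU.2]; push_cast; ring⟩, hSU, rfl⟩

theorem collinear_quotient_iff (hS : S ∈ G.flats m) {Y Z : G.quotientPoints S} :
    (G.quotient S).Collinear Y Z ↔ ∃ U ∈ G.flats (m + 2), Y.1 ⊆ U ∧ Z.1 ⊆ U := by
  constructor
  · rintro ⟨L, hL, hY, hZ⟩
    obtain ⟨U, hU, -, rfl⟩ := (mem_quotient_lines hS).1 hL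
    exact ⟨U, hU, hY, hZ⟩
  · rintro ⟨U, hU, hY, hZ⟩
    exact ⟨_, (mem_quotient_lines hS).2 ⟨U, hU, Y.2.1.trans hY, rfl⟩, hY, hZ⟩

theorem adjoin_eq_of_mem_quotientPoints (hS : S ∈ G.flats m) {Z : G.quotientPoints S} {q : P}
    (hq : q ∈ Z.1) (hqS : q ∉ S) : G.adjoin S q = Z.1 := by
  obtain ⟨hSZ, hZ⟩ := (mem_quotientPoints hS).1 Z.2
  exact adjoin_eq_of_mem_flats hS hZ hSZ hq hqS

theorem isSubspace_setOf_subset (hS : S ∈ G.flats m) (hX : G.IsSubspace X) :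
    (G.quotient S).IsSubspace {Y | Y.1 ⊆ X} := by
  intro Y hY Z hZ hne L hL hYL hZL V hV
  obtain ⟨U, hU, -, rfl⟩ := (mem_quotient_lines hS).1 hL
  have hYZ := eq_span_union ((mem_quotientPoints hS).1 Y.2).2 ((mem_quotientPoints hS).1 Z.2).2 hU
    (Subtype.coe_ne_coe.2 hne) hYL hZL
  have hUX : U ⊆ X := hYZ ▸ span_subset hX (Set.union_subset hY hZ)
  exact Set.Subset.trans hV hUX

theorem isSubspace_union_iUnion (hS : S ∈ G.flats m) (hX : G.IsSingular X)
    {T : Set (G.quotientPoints S)} (hT : (G.quotient S).IsSubspace T) (hTX : ∀ Z ∈ T, Z.1 ⊆ X) :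
    G.IsSubspace (S ∪ ⋃ Z ∈ T, Z.1) := by
  have hpt (Z : G.quotientPoints S) := (mem_quotientPoints hS).1 Z.2
  have hmem {Z} (hZ : Z ∈ T) {q} (hq : q ∈ Z.1) : q ∈ S ∪ ⋃ Z ∈ T, Z.1 :=
    Or.inr (Set.mem_biUnion hZ hq)
  intro a ha b hb hab L hL haL hbL q hq
  have hline {A} (hA : G.IsSubspace A) (haA : a ∈ A) (hbA : b ∈ A) : q ∈ A :=
    hA a haA b hbA hab L hL haL hbL hq
  simp only [Set.mem_union, Set.mem_iUnion] at ha hb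
  rcases ha with ha | ⟨Y, hYT, ha⟩ <;> rcases hb with hb | ⟨Z, hZT, hb⟩
  · exact Or.inl (hline hS.1.1 ha hb)
  · exact hmem hZT (hline (hpt Z).2.1.1 ((hpt Z).1 ha) hb)
  · exact hmem hYT (hline (hpt Y).2.1.1 ha ((hpt Y).1 hb))
  by_cases hYZ : Y = Z
  · exact hmem hZT (hline (hpt Z).2.1.1 (hYZ ▸ ha) hb)
  by_cases hqS : q ∈ S
  · exact Or.inl hqS
  have hnbr := neighbors_of_hyperplane hS (hpt Y).2 (hpt Z).2 (Subtype.coe_ne_coe.2 hYZ) (hpt Y).1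
    (hpt Z).1 ((hTX Y hYT).trans (hX.subset_perp.trans (perp_anti (hTX Z hZT))))
  have hU := hnbr.span_union_mem_flats
  have hYU := Set.subset_union_left.trans (subset_span (G := G) (Y.1 ∪ Z.1))
  have hZU := Set.subset_union_right.trans (subset_span (G := G) (Y.1 ∪ Z.1))
  have hSU := (hpt Y).1.trans hYU
  have hqU := hline hU.1.1 (hYU ha) (hZU hb)
  have hV := (mem_quotientPoints hS).2
    ⟨subset_adjoin S q, adjoin_mem_flats hS (hU.1.mem_residue hSU hqU hqS)⟩
  refine hmem (Z := ⟨_, hV⟩) ?_ (mem_adjoin S q)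
  exact hT Y hYT Z hZT hYZ _ ((mem_quotient_lines hS).2 ⟨_, hU, hSU, rfl⟩) hYU hZU
    (adjoin_subset hU.1.1 hSU hqU)

theorem mem_of_subset_union_iUnion (hS : S ∈ G.flats m) {T : Set (G.quotientPoints S)}
    {Y : G.quotientPoints S} (h : Y.1 ⊆ S ∪ ⋃ Z ∈ T, Z.1) : Y ∈ T := by
  have hY := ((mem_quotientPoints hS).1 Y.2).2
  obtain ⟨q, hq, hqS⟩ := hY.1.exists_mem_notMem hS.1 (by rw [hS.2, hY.2]; lia)
  obtain ⟨Z, hZ, hqZ⟩ : ∃ Z ∈ T, q ∈ Z.1 := by simpa [hqS] using h hq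
  rwa [Subtype.ext ((adjoin_eq_of_mem_quotientPoints hS hq hqS).symm.trans
    (adjoin_eq_of_mem_quotientPoints hS hqZ hqS))]

end Quotient

section PointEmbedding

variable {P' : Type v} {G' : PointLineGeometry P'} {J k k' m n : ℕ} {F : Set P → Set P'}
  {f : G.grassmannian k → G'.grassmannian k'} {N : Set P} {S : Set P'} {p q : P}

variable [G.IsShultSpace]

theorem IsLocalEmbedding.singleton_mem_flats (hF : G.IsLocalEmbedding G' 0 J F) (p : P) :
    F {p} ∈ G'.flats (J + 1) :=
  hF.mapsTo (PointLineGeometry.singleton_mem_flats p)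

theorem IsLocalEmbedding.neighbors_singleton (hF : G.IsLocalEmbedding G' 0 J F)
    (hpq : G.Collinear p q) (hne : p ≠ q) : G'.Neighbors J (F {p}) (F {q}) :=
  hF.neighbors _ _ (PointLineGeometry.neighbors_singleton hpq hne)

theorem IsDescent.subset_of_forall_subset_singleton (h : G.IsDescent G' f 0 J F)
    (hSF : ∀ p, S ⊆ F {p}) (X : G.grassmannian k) : S ⊆ (f X).1 := by
  have hr := (mem_grassmannian_iff.1 X.2).2
  obtain ⟨p, hp, -⟩ := X.2.1.exists_mem_notMem isSingular_empty (by rw [rk_empty]; lia)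
  exact (hSF p).trans
    (h.subset (PointLineGeometry.singleton_mem_flats p) (Set.singleton_subset_iff.2 hp))

variable [G'.IsShultSpace]

theorem IsLocalEmbedding.subset_perp_singleton_iff (hF : G.IsLocalEmbedding G' 0 J F)
    (hS : S ∈ G'.flats J) (hSF : ∀ p, S ⊆ F {p}) :
    F {p} ⊆ G'.perp (F {q}) ↔ G.Collinear p q := by
  refine ⟨fun h => ?_, fun hpq => ?_⟩
  · by_contra hpq
    obtain ⟨hne, hnot⟩ := hF.not_neighbors ∅ empty_mem_flats _
      (PointLineGeometry.singleton_mem_flats p) _ (PointLineGeometry.singleton_mem_flats q)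
      (Set.empty_subset _) (Set.empty_subset _) fun h => hpq (mem_perp_singleton.1 (h rfl))
    exact hnot (neighbors_of_hyperplane hS (hF.singleton_mem_flats p) (hF.singleton_mem_flats q)
      hne (hSF p) (hSF q) h)
  · by_cases hne : p = q
    · exact hne ▸ (hF.singleton_mem_flats p).1.subset_perp
    · exact (hF.neighbors_singleton hpq hne).subset_perp

/-- Adjoining a point `p` to `N` raises the rank of `V` because some point perpendicular to `N` is
not collinear to `p`, so that `F {p} ⊈ V`. -/
theorem IsLocalEmbedding.exists_isSingular_rk_add_le (hF : G.IsLocalEmbedding G' 0 J F)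
    (hS : S ∈ G'.flats J) (hSF : ∀ p, S ⊆ F {p}) (hN : G.IsSingular N) :
    ∃ V, G'.IsSingular V ∧ J + G.rk N ≤ G'.rk V ∧ ∀ q ∈ G.perp N, F {q} ⊆ G'.perp V := by
  induction hN using IsSingular.induction with
  | empty => exact ⟨S, hS.1, by rw [hS.2, rk_empty, Nat.add_zero], fun q _ =>
      (hF.singleton_mem_flats q).1.subset_perp.trans (perp_anti (hSF q))⟩
  | adjoin N p hN hp ih =>
    obtain ⟨V, hV, hr, hperp⟩ := ih
    obtain ⟨q, hq, hqp⟩ := exists_mem_residue_not_collinear hN hp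
    have hpV : ¬ F {p} ⊆ V := fun h =>
      hqp ((hF.subset_perp_singleton_iff hS hSF).1 ((hperp q hq.1).trans (perp_anti h)))
    obtain ⟨y, hy, hyV⟩ := Set.not_subset.1 hpV
    have hyres : y ∈ G'.residue V := ⟨hperp p hp.1 hy, hyV⟩
    refine ⟨G'.adjoin V y, isSingular_adjoin hV hyres.1, ?_, fun q hq x hx => ?_⟩
    · rw [rk_adjoin hN hp, rk_adjoin hV hyres]
      lia
    · obtain ⟨hqp, hqN⟩ := mem_perp_adjoin.1 hq
      exact mem_perp_adjoin.2
        ⟨(hF.subset_perp_singleton_iff hS hSF).2 hqp hx y hy, hperp q hqN hx⟩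

/-- The map to the points of the quotient by `S` that is given by a local embedding of points,
provided that the images of all points contain `S`. -/
def IsLocalEmbedding.quotientMap (hF : G.IsLocalEmbedding G' 0 J F) (hS : S ∈ G'.flats J)
    (hSF : ∀ p, S ⊆ F {p}) (p : P) : G'.quotientPoints S :=
  ⟨F {p}, (mem_quotientPoints hS).2 ⟨hSF p, hF.singleton_mem_flats p⟩⟩

theorem IsLocalEmbedding.collinear_quotientMap (hF : G.IsLocalEmbedding G' 0 J F)
    (hS : S ∈ G'.flats J) (hSF : ∀ p, S ⊆ F {p}) (hpq : G.Collinear p q) (hne : p ≠ q) :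
    (G'.quotient S).Collinear (hF.quotientMap hS hSF p) (hF.quotientMap hS hSF q) :=
  (collinear_quotient_iff hS).2 ⟨_, (hF.neighbors_singleton hpq hne).span_union_mem_flats,
    Set.subset_union_left.trans (subset_span _), Set.subset_union_right.trans (subset_span _)⟩

theorem IsLocalEmbedding.isCollinearityPreservingInjection_quotientMap
    (hF : G.IsLocalEmbedding G' 0 J F) (hn : G.HasRank n) (h2n : 2 ≤ n) (hS : S ∈ G'.flats J)
    (hSF : ∀ p, S ⊆ F {p}) :
    G.IsCollinearityPreservingInjection (G'.quotient S) (hF.quotientMap hS hSF) where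
  injective p q hpq := by
    have hFpq : F {p} = F {q} := congrArg Subtype.val hpq
    by_contra hne
    refine (hF.neighbors_singleton ((hF.subset_perp_singleton_iff hS hSF).1 ?_) hne).ne hFpq
    exact hFpq ▸ (hF.singleton_mem_flats p).1.subset_perp
  collinear_iff p q := by
    refine ⟨fun h => ?_, fun hpq => ?_⟩
    · obtain ⟨U, hU, hpU, hqU⟩ := (collinear_quotient_iff hS).1 h
      exact (hF.subset_perp_singleton_iff hS hSF).1
        (hpU.trans (hU.1.subset_perp.trans (perp_anti hqU)))
    · by_cases hne : p = q
      · subst hne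
        have hp := PointLineGeometry.singleton_mem_flats (G := G) p
        obtain ⟨r, hr⟩ := hn.exists_mem_residue hp.1 (by rw [hp.2]; lia)
        obtain ⟨L, hL, hpL, -⟩ := hF.collinear_quotientMap hS hSF (mem_perp_singleton.1 hr.1).symm
          fun h => hr.2 h.symm
        exact ⟨L, hL, hpL, hpL⟩
      · exact hF.collinear_quotientMap hS hSF hpq hne

theorem IsDescent.isInducedBy_quotientMap
    (h : G.IsDescent G' f 0 J F) (hS : S ∈ G'.flats J) (hSF : ∀ p, S ⊆ F {p}) :
    G.IsInducedBy G' f S (h.isLocalEmbedding.quotientMap hS hSF) := by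
  intro X
  set α := h.isLocalEmbedding.quotientMap hS hSF
  have hle : (G'.quotient S).span (α '' X.1) ⊆ {Y | Y.1 ⊆ (f X).1} := by
    refine span_subset (isSubspace_setOf_subset hS (f X).2.1.1) ?_
    rintro _ ⟨p, hp, rfl⟩
    exact h.subset (PointLineGeometry.singleton_mem_flats p) (Set.singleton_subset_iff.2 hp)
  refine hle.antisymm fun Y hY => mem_of_subset_union_iUnion hS (Set.Subset.trans hY ?_)
  have hT := isSubspace_union_iUnion hS (f X).2.1 (isSubspace_span (α '' X.1)) fun Z hZ => hle hZ
  refine (h.subset_iff X _ hT).2 fun R hR hRX => ?_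
  obtain ⟨p, rfl⟩ := exists_eq_singleton hR
  have hp := subset_span (G := G'.quotient S) _ (Set.mem_image_of_mem α (hRX rfl))
  exact fun y hy => Or.inr (Set.mem_biUnion hp hy)

end PointEmbedding

section PolarSpaces

variable {n : ℕ}

theorem IsPolarSpace.isShultSpace (h : G.IsPolarSpace) : G.IsShultSpace where
  exists_line := h.exists_line
  exists_collinear L hL p := by
    rcases h.one_or_all p L hL with ⟨q, hq, -⟩ | hall
    · exact ⟨q, hq.1, hq.2⟩
    · obtain ⟨q, hq⟩ := (h.line_nontrivial L hL).nonempty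
      exact ⟨q, hq, hall q hq⟩
  collinear_of_mem_line L hL p q hq r hr hqr hpq hpr :=
    (h.one_or_all p L hL).resolve_left fun hex => hqr (hex.unique ⟨hq, hpq⟩ ⟨hr, hpr⟩)
  exists_not_collinear := by simpa only [not_exists, not_forall] using h.not_collinear_all
  finite_chain := h.finite_chain

/-- The bijection `α` on points is a collineation of `G` onto the standard thin polar space of
rank `n`, so that `α` gives coordinates on `G`. -/
def IsThinChart (G : PointLineGeometry P) (α : P ≃ Fin n × Bool) : Prop :=
  (fun L => α '' L) '' G.lines = (standardThin n).lines

namespace IsThinChart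

variable {α : P ≃ Fin n × Bool} {x y : P}

theorem mem_lines_iff (h : G.IsThinChart α) {L : Set P} :
    L ∈ G.lines ↔ ∃ x y, (α x).1 ≠ (α y).1 ∧ L = {x, y} := by
  rw [← α.injective.image_injective.mem_set_image, h]
  constructor
  · rintro ⟨x, y, hxy, hL⟩
    refine ⟨α.symm x, α.symm y, by simpa using hxy, α.injective.image_injective ?_⟩
    simp only [hL, Set.image_pair, Equiv.apply_symm_apply]
  · rintro ⟨x, y, hxy, rfl⟩
    exact ⟨α x, α y, hxy, Set.image_pair _ _ _⟩

theorem collinear_iff (h : G.IsThinChart α) (hn : 2 ≤ n) :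
    G.Collinear x y ↔ x = y ∨ (α x).1 ≠ (α y).1 := by
  constructor
  · rintro ⟨L, hL, hx, hy⟩
    obtain ⟨a, b, hab, rfl⟩ := h.mem_lines_iff.1 hL
    rcases hx with rfl | rfl <;> rcases hy with rfl | rfl
    exacts [Or.inl rfl, Or.inr hab, Or.inr hab.symm, Or.inl rfl]
  · rintro (rfl | hxy)
    · have : Nontrivial (Fin n) := Fin.nontrivial_iff_two_le.2 hn
      obtain ⟨i, hi⟩ := exists_ne (α x).1
      exact ⟨{x, α.symm (i, true)}, h.mem_lines_iff.2 ⟨x, _, by simpa using hi.symm, rfl⟩,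
        by simp, by simp⟩
    · exact ⟨{x, y}, h.mem_lines_iff.2 ⟨x, y, hxy, rfl⟩, by simp, by simp⟩

theorem isSubspace (h : G.IsThinChart α) (S : Set P) : G.IsSubspace S := by
  intro p hp q hq hpq L hL hpL hqL x hx
  obtain ⟨a, b, -, rfl⟩ := h.mem_lines_iff.1 hL
  grind

theorem isShultSpace (h : G.IsThinChart α) (hn : 2 ≤ n) : G.IsShultSpace where
  exists_line p := by
    obtain ⟨L, hL, hp, -⟩ := (h.collinear_iff hn (x := p)).2 (Or.inl rfl)
    exact ⟨L, hL, hp⟩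
  exists_collinear L hL p := by
    obtain ⟨a, b, hab, rfl⟩ := h.mem_lines_iff.1 hL
    by_cases hpa : (α p).1 = (α a).1
    · exact ⟨b, by simp, (h.collinear_iff hn).2 (Or.inr (hpa ▸ hab))⟩
    · exact ⟨a, by simp, (h.collinear_iff hn).2 (Or.inr hpa)⟩
  collinear_of_mem_line L hL p q hq r hr hqr hpq hpr s hs := by
    obtain ⟨a, b, -, rfl⟩ := h.mem_lines_iff.1 hL
    grind
  exists_not_collinear p := by
    refine ⟨α.symm ((α p).1, !(α p).2), fun hp => ?_⟩
    rcases (h.collinear_iff hn).1 hp with hp | hp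
    · simpa using congrArg (fun x => (α x).2) hp
    · simp at hp
  finite_chain C _ _ :=
    have : Finite P := .of_equiv _ α.symm
    C.toFinite

theorem ncard_of_maximal (h : G.IsThinChart α) (hn : 2 ≤ n) {M : Set P}
    (hM : Maximal G.IsSingular M) : M.ncard = n := by
  have := h.isShultSpace hn
  have hinj : Set.InjOn (fun x => (α x).1) M := fun x hx y hy hxy =>
    ((h.collinear_iff hn).1 (hM.1.subset_perp hx y hy)).resolve_right fun hne => hne hxy
  have hsurj : (fun x => (α x).1) '' M = Set.univ := by
    refine Set.eq_univ_of_forall fun i => ?_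
    by_contra hi
    have hp : α.symm (i, true) ∈ G.perp M := fun x hx =>
      (h.collinear_iff hn).2 (Or.inr fun hxi => hi ⟨x, hx, by simpa using hxi.symm⟩)
    have hpM := hM.2 (isSingular_adjoin hM.1 hp) (subset_adjoin M _) (mem_adjoin M _)
    exact hi ⟨_, hpM, by simp⟩
  rw [← hinj.ncard_image, hsurj, Set.ncard_univ, Nat.card_fin]

theorem hasRank (h : G.IsThinChart α) (hn : 2 ≤ n) : G.HasRank n := by
  have : Finite P := .of_equiv _ α.symm
  intro M hM
  refine ⟨⟨M.toFinite.toFinset, ?_, ?_⟩, ?_⟩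
  · rw [(h.isSubspace _).span_eq, Set.Finite.coe_toFinset]
  · rw [← Set.ncard_eq_toFinset_card M, h.ncard_of_maximal hn hM]
  · rintro _ ⟨X, rfl, rfl⟩
    rw [(h.isSubspace _).span_eq] at hM
    rw [← h.ncard_of_maximal hn hM, Set.ncard_coe_finset]

end IsThinChart

theorem IsThinPolarSpace.isShultSpace (h : G.IsThinPolarSpace n) (hn : 2 ≤ n) :
    G.IsShultSpace :=
  have ⟨_, hα⟩ := h
  IsThinChart.isShultSpace hα hn

theorem IsThinPolarSpace.hasRank (h : G.IsThinPolarSpace n) (hn : 2 ≤ n) : G.HasRank n :=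
  have ⟨_, hα⟩ := h
  IsThinChart.hasRank hα hn

end PolarSpaces

end PointLineGeometry

open PointLineGeometry in
theorem theorem1_general {P : Type*} {P' : Type*} (G : PointLineGeometry P)
    (G' : PointLineGeometry P') [G.IsShultSpace] [G'.IsShultSpace] (n n' k k' : ℕ)
    (hn : G.HasRank n) (hn' : G'.HasRank n') (hkn : k + 4 ≤ n)
    (f : G.grassmannGraph n k ↪g G'.grassmannGraph n' k')
    (hf : ∀ X Y, (G'.grassmannGraph n' k').edist (f X) (f Y) =
      (G.grassmannGraph n k).edist X Y) :
    k ≤ k' ∧ (n : ℤ) - k ≤ (n' : ℤ) - k' ∧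
    ∃ S ∈ G'.grassmannian ((k' : ℤ) - k - 1),
      Set.range f ⊆ G'.bigStar S k' ∧
      ∃ α : P → G'.quotientPoints S,
        G.IsCollinearityPreservingInjection (G'.quotient S) α ∧
        G.IsInducedBy G' f S α := by
  obtain ⟨J, F, h⟩ := exists_isDescent hn hn' hkn f hf
  have hF := h.isLocalEmbedding
  have hadd := h.add_eq
  have hS := hF.starMap_mem_flats hn (by lia) empty_mem_flats
  have hSF (p : P) : G.starMap 0 F ∅ ⊆ F {p} :=
    starMap_subset (singleton_mem_flats p) (Set.empty_subset _)
  obtain ⟨M, hM⟩ := hn.exists_mem_flats le_rfl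
  obtain ⟨V, hV, hr, -⟩ := hF.exists_isSingular_rk_add_le hS hSF hM.1
  have hrn := hM.2 ▸ hr.trans (hn'.rk_le hV)
  refine ⟨by lia, by lia, _, mem_grassmannian_iff.2 ⟨hS.1, by rw [hS.2]; lia⟩, ?_,
    hF.quotientMap hS hSF, hF.isCollinearityPreservingInjection_quotientMap hn (by lia) hS hSF,
    h.isInducedBy_quotientMap hS hSF⟩
  rintro _ ⟨X, rfl⟩
  exact h.subset_of_forall_subset_singleton hSF X

theorem theorem1 {P : Type*} {P' : Type*} (G : PointLineGeometry P) (G' : PointLineGeometry P')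
    (n n' k k' : ℕ)
    (hG : (G.IsPolarSpace ∧ G.HasRank n) ∨ G.IsThinPolarSpace n)
    (hG' : G'.IsPolarSpace) (hn' : G'.HasRank n')
    (hn : 5 ≤ n) (hk : 1 ≤ k) (hkn : k + 4 ≤ n)
    (f : G.grassmannGraph n k ↪g G'.grassmannGraph n' k')
    (hf : ∀ X Y, (G'.grassmannGraph n' k').edist (f X) (f Y) =
      (G.grassmannGraph n k).edist X Y) :
    k ≤ k' ∧ (n : ℤ) - k ≤ (n' : ℤ) - k' ∧
    ∃ S ∈ G'.grassmannian ((k' : ℤ) - k - 1),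
      Set.range f ⊆ G'.bigStar S k' ∧
      ∃ α : P → G'.quotientPoints S,
        G.IsCollinearityPreservingInjection (G'.quotient S) α ∧
        G.IsInducedBy G' f S α := by
  have h : G.IsShultSpace ∧ G.HasRank n :=
    hG.elim (.imp_left (·.isShultSpace)) fun h => ⟨h.isShultSpace (by lia), h.hasRank (by lia)⟩
  exact @theorem1_general _ _ G G' h.1 hG'.isShultSpace n n' k k' h.2 hn' hkn f hf
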